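/- Let $k,n,s$ be integers with $1\le s\le k\le n-k$, let $G(k,n)$ be the Grassmannian of $k$-dimensional linear subspaces of $\mathbb R^n$ (with its usual topology), and fix $\mathbf W\in G(k,n)$. For $\mathbf E,\mathbf F\in G(k,n)$, principal vectors $(p_1,q_1),\dots,(p_k,q_k)$ between $\mathbf E$ and $\mathbf F$ are chosen recursively: $(p_i,q_i)$ maximizes $\langle p,q\rangle$ over all unit vectors $p\in\mathbf E$, $p\perp p_1,\dots,p_{i-1}$ and $q\in\mathbf F$, $q\perp q_1,\dots,q_{i-1}$. The principal angles between $\mathbf E$ and $\mathbf F$ are $\theta_i(\mathbf E,\mathbf F)=\arccos\langle p_i,q_i\rangle\in[0,\pi/2]$, $i=1,\dots,k$; they are nondecreasing in $i$ and do not depend on the choice of principal vectors. The Grassmann distance is $$\delta(\mathbf E,\mathbf F)=\Big(\sum_{i=1}^k\theta_i(\mathbf E,\mathbf F)^2\Big)^{1/2}.$$ Write $\delta_{\mathbf L}(\mathbf E)=\delta(\mathbf L,\mathbf E)$ and $\theta_i(\mathbf L)=\theta_i(\mathbf L,\mathbf W)$, and let $$\Omega_s=\{\mathbf E\in G(k,n)\;:\;\dim(\mathbf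 E\cap\mathbf W)\ge s\}.$$ (1) The set of all $\mathbf L\in G(k,n)$ with $0<\theta_1(\mathbf L)<\dots<\theta_k(\mathbf L)<\frac{\pi}{2}$ is generic: it contains a dense subset of $G(k,n)$ of the form $\{\mathbf L : P(\mathbf L)\neq 0\}$, where $P$ is a real polynomial in the entries of the matrix of the orthogonal projection onto $\mathbf L$. (2) Every $\mathbf L$ with $0<\theta_1(\mathbf L)<\dots<\theta_k(\mathbf L)<\frac{\pi}{2}$ satisfies $\mathbf L\notin\Omega_s$, the function $\delta_{\mathbf L}$ attains a maximum on $\Omega_s$, and $$\max\delta_{\mathbf L}|_{\Omega_s}=\Big(\theta_{k-s+1}(\mathbf L)^2+\dots+\theta_k(\mathbf L)^2+(k-s)\big(\tfrac{\pi}{2}\big)^2\Big)^{1/2}.$$ Moreover, let $(p_1,q_1),\dots,(p_k,q_k)$ be any principal vectors between $\mathbf L$ and $\mathbf W$, and put $\mathbf E_{\mathbf W}=\mathrm{span}\{q_{k-s+1},\dots,q_k\}$ and $\mathbf A=\mathbf L^\perp\cap\mathbf E_{\mathbf W}^\perp$. Then $\dim\mathbf E_{\mathbf W}=s$, $\dim\mathbf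 A=n-k-s$, and the global maximizers of $\delta_{\mathbf L}|_{\Omega_s}$ are exactly the planes $\mathbf B\oplus\mathbf E_{\mathbf W}$, where $\mathbf B$ is a $(k-s)$-dimensional subspace of $\mathbf A$. The set of global maximizers is a copy of the Grassmannian $G(k-s,n-k-s)$: for every linear isometric embedding $\varphi:\mathbb R^{n-k-s}\to\mathbb R^n$ with image $\mathbf A$, the map $$G(k-s,n-k-s)\to G(k,n),\qquad \mathbf B\mapsto\varphi(\mathbf B)\oplus\mathbf E_{\mathbf W}$$ is a topological embedding whose image is the set of global maximizers of $\delta_{\mathbf L}|_{\Omega_s}$. -/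

import Mathlib

open scoped RealInnerProductSpace

/-- Euclidean space `ℝⁿ` with its standard scalar product. -/
abbrev Euc (n : ℕ) : Type := EuclideanSpace ℝ (Fin n)

/-- The real Grassmannian `G(k,n)` of `k`-dimensional linear subspaces of `ℝⁿ`. -/
def Grass (k n : ℕ) : Type := {E : Submodule ℝ (Euc n) // Module.finrank ℝ E = k}

namespace Grass

/-- The linear subspace underlying a point of the Grassmannian. -/
def space {k n : ℕ} (E : Grass k n) : Submodule ℝ (Euc n) := E.1

theorem finrank_space {k n : ℕ} (E : Grass k n) : Module.finrank ℝ E.space = k := E.2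

/-- The usual topology of `G(k,n)`: a plane is identified with the orthogonal projection onto it. -/
noncomputable instance (k n : ℕ) : TopologicalSpace (Grass k n) :=
  TopologicalSpace.induced (fun E : Grass k n => E.space.starProjection) inferInstance

/-- The entries of the matrix of the orthogonal projection onto a plane. These embed `G(k,n)` as a
real algebraic subset of the space of `n × n` matrices. -/
noncomputable def coord {k n : ℕ} (E : Grass k n) (ij : Fin n × Fin n) : ℝ :=
  ⟪EuclideanSpace.single ij.1 (1 : ℝ),
    E.space.starProjection (EuclideanSpace.single ij.2 (1 : ℝ))⟫

/-- A set of planes is generic if it contains a dense Zariski-open subset of `G(k,n)`, of the form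
`{E | P(E) ≠ 0}` with `P` a polynomial in the entries of the projection matrix. -/
def IsGeneric {k n : ℕ} (U : Set (Grass k n)) : Prop :=
  ∃ P : MvPolynomial (Fin n × Fin n) ℝ,
    Dense {E : Grass k n | MvPolynomial.eval E.coord P ≠ 0} ∧
      {E : Grass k n | MvPolynomial.eval E.coord P ≠ 0} ⊆ U

/-- The pairs `(x, y)` that are admissible at step `i` of the algorithm for principal vectors
between `E` and `F`, when `p j`, `q j` (for `j < i`) have been chosen. -/
def Admissible {k n : ℕ} (E F : Grass k n) (p q : Fin k → Euc n) (i : Fin k)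
    (x y : Euc n) : Prop :=
  (x ∈ E.space ∧ ‖x‖ = 1 ∧ ∀ j, j < i → ⟪x, p j⟫ = 0) ∧
    (y ∈ F.space ∧ ‖y‖ = 1 ∧ ∀ j, j < i → ⟪y, q j⟫ = 0)

/-- `(p 0, q 0), …, (p (k-1), q (k-1))` are principal vectors between `E` and `F`:
at every step the pair `(p i, q i)` maximizes the scalar product among the admissible pairs. -/
def IsPrincipalVectors {k n : ℕ} (E F : Grass k n) (p q : Fin k → Euc n) : Prop :=
  ∀ i, Admissible E F p q i (p i) (q i) ∧
    ∀ x y, Admissible E F p q i x y → ⟪x, y⟫ ≤ ⟪p i, q i⟫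

theorem exists_unit_orthogonal {n k : ℕ} (S : Submodule ℝ (Euc n))
    (p : Fin k → Euc n) (i : Fin k) (hS : (i : ℕ) < Module.finrank ℝ S) :
    ∃ x ∈ S, ‖x‖ = 1 ∧ ∀ j, j < i → ⟪x, p j⟫ = 0 := by
  let f : S →ₗ[ℝ] ({j : Fin k // j < i} → ℝ) :=
    LinearMap.pi fun j => (innerₛₗ ℝ (p j.1)).comp S.subtype
  have hcard : Module.finrank ℝ ({j : Fin k // j < i} → ℝ) = i := by
    rw [Module.finrank_pi, Fintype.card_subtype]
    have : (Finset.univ.filter fun j : Fin k => j < i) = Finset.Iio i := by ext; simp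
    rw [this, Fin.card_Iio]
  have hlt : Module.finrank ℝ ({j : Fin k // j < i} → ℝ) < Module.finrank ℝ S := by
    rw [hcard]; exact hS
  have hker := LinearMap.ker_ne_bot_of_finrank_lt (f := f) hlt
  obtain ⟨z, hz, hz0⟩ := Submodule.exists_mem_ne_zero_of_ne_bot hker
  have hz0' : (z : Euc n) ≠ 0 := by simpa using hz0
  refine ⟨‖(z : Euc n)‖⁻¹ • (z : Euc n), S.smul_mem _ z.2, ?_, ?_⟩
  · rw [norm_smul, norm_inv, norm_norm, inv_mul_cancel₀ (norm_ne_zero_iff.2 hz0')]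
  · intro j hj
    have h1 : f z ⟨j, hj⟩ = 0 := by rw [LinearMap.mem_ker.1 hz]; rfl
    have h2 : ⟪p j, (z : Euc n)⟫ = 0 := h1
    rw [real_inner_smul_left, real_inner_comm, h2, mul_zero]

theorem exists_best {k n : ℕ} (E F : Grass k n) (p q : Fin k → Euc n) (i : Fin k) :
    ∃ x y, Admissible E F p q i x y ∧ ∀ x' y', Admissible E F p q i x' y' → ⟪x', y'⟫ ≤ ⟪x, y⟫ := by
  have key : ∀ (G : Grass k n) (r : Fin k → Euc n),
      IsCompact {x : Euc n | x ∈ G.space ∧ ‖x‖ = 1 ∧ ∀ j, j < i → ⟪x, r j⟫ = 0} := by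
    intro G r
    refine (isCompact_sphere (0 : Euc n) 1).of_isClosed_subset ?_ ?_
    · have h1 : IsClosed {x : Euc n | x ∈ G.space} := G.space.closed_of_finiteDimensional
      have h2 : IsClosed {x : Euc n | ‖x‖ = 1} := isClosed_eq continuous_norm continuous_const
      have h3 : IsClosed {x : Euc n | ∀ j, j < i → ⟪x, r j⟫ = 0} := by
        simp only [Set.ofPred_forall]
        refine isClosed_iInter fun j => isClosed_iInter fun _ => ?_
        exact isClosed_eq (by fun_prop) continuous_const
      exact h1.inter (h2.inter h3)
    · intro x hx
      simpa using hx.2.1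
  have hne : ∀ (G : Grass k n) (r : Fin k → Euc n),
      {x : Euc n | x ∈ G.space ∧ ‖x‖ = 1 ∧ ∀ j, j < i → ⟪x, r j⟫ = 0}.Nonempty := by
    intro G r
    obtain ⟨x, h1, h2, h3⟩ := exists_unit_orthogonal G.space r i (by
      rw [G.finrank_space]; exact i.2)
    exact ⟨x, h1, h2, h3⟩
  obtain ⟨z, hz, hmax⟩ := ((key E p).prod (key F q)).exists_isMaxOn ((hne E p).prod (hne F q))
    (f := fun z : Euc n × Euc n => ⟪z.1, z.2⟫) (by fun_prop)
  exact ⟨z.1, z.2, ⟨hz.1, hz.2⟩, fun x' y' h => hmax (a := (x', y')) ⟨h.1, h.2⟩⟩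

theorem exists_isPrincipalVectors {k n : ℕ} (E F : Grass k n) :
    ∃ p q : Fin k → Euc n, IsPrincipalVectors E F p q := by
  have step : ∀ m : ℕ, m ≤ k → ∃ p q : Fin k → Euc n, ∀ i : Fin k, (i : ℕ) < m →
      (Admissible E F p q i (p i) (q i) ∧
        ∀ x y, Admissible E F p q i x y → ⟪x, y⟫ ≤ ⟪p i, q i⟫) := by
    intro m
    induction m with
    | zero => exact fun _ => ⟨0, 0, fun i hi => absurd hi (Nat.not_lt_zero _)⟩
    | succ m ih =>
      intro hm
      obtain ⟨p, q, h⟩ := ih (by omega)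
      let a : Fin k := ⟨m, hm⟩
      obtain ⟨x, y, hxy, hmax⟩ := exists_best E F p q a
      have hp : ∀ j : Fin k, (j : ℕ) < m → Function.update p a x j = p j := fun j hj =>
        Function.update_of_ne (by rintro rfl; exact lt_irrefl _ hj) _ _
      have hq : ∀ j : Fin k, (j : ℕ) < m → Function.update q a y j = q j := fun j hj =>
        Function.update_of_ne (by rintro rfl; exact lt_irrefl _ hj) _ _
      have hadm : ∀ i : Fin k, (i : ℕ) ≤ m → ∀ u v,
          (Admissible E F (Function.update p a x) (Function.update q a y) i u v ↔
            Admissible E F p q i u v) := by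
        intro i hi u v
        have e1 : ∀ j : Fin k, j < i → Function.update p a x j = p j := fun j hj =>
          hp j (lt_of_lt_of_le hj hi)
        have e2 : ∀ j : Fin k, j < i → Function.update q a y j = q j := fun j hj =>
          hq j (lt_of_lt_of_le hj hi)
        unfold Admissible
        refine and_congr (and_congr Iff.rfl (and_congr Iff.rfl ?_))
          (and_congr Iff.rfl (and_congr Iff.rfl ?_))
        · exact forall_congr' fun j => forall_congr' fun hj => by rw [e1 j hj]
        · exact forall_congr' fun j => forall_congr' fun hj => by rw [e2 j hj]
      refine ⟨Function.update p a x, Function.update q a y, fun i hi => ?_⟩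
      rcases Nat.lt_succ_iff_lt_or_eq.1 hi with hlt | heq
      · simp only [hadm i hlt.le, hp i hlt, hq i hlt]
        exact h i hlt
      · have hia : i = a := Fin.ext heq
        rw [hia]
        simp only [hadm a le_rfl, Function.update_self]
        exact ⟨hxy, hmax⟩
  obtain ⟨p, q, h⟩ := step k le_rfl
  exact ⟨p, q, fun i => h i i.2⟩

/-- The principal angles between `E` and `F`, in nondecreasing order: `principalAngle E F i` is
`arccos ⟪p i, q i⟫` for principal vectors `p, q` between `E` and `F`. By `principalAngle_eq` below
it does not depend on their choice. -/
noncomputable def principalAngle {k n : ℕ} (E F : Grass k n) (i : Fin k) : ℝ :=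
  Real.arccos ⟪(exists_isPrincipalVectors E F).choose i,
    (exists_isPrincipalVectors E F).choose_spec.choose i⟫

namespace IsPrincipalVectors

variable {k n : ℕ} {E F : Grass k n} {p q : Fin k → Euc n}

theorem symm (h : IsPrincipalVectors E F p q) : IsPrincipalVectors F E q p := fun i =>
  ⟨⟨(h i).1.2, (h i).1.1⟩, fun x y hxy => by
    rw [real_inner_comm, real_inner_comm (p i)]; exact (h i).2 y x ⟨hxy.2, hxy.1⟩⟩

theorem orthonormal_left (h : IsPrincipalVectors E F p q) : Orthonormal ℝ p := by
  refine ⟨fun i => (h i).1.1.2.1, fun i j hij => ?_⟩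
  rcases lt_or_gt_of_ne hij with hlt | hlt
  · rw [real_inner_comm]; exact (h j).1.1.2.2 i hlt
  · exact (h i).1.1.2.2 j hlt

theorem nonneg (h : IsPrincipalVectors E F p q) (i : Fin k) : 0 ≤ ⟪p i, q i⟫ := by
  have := (h i).2 (-(p i)) (q i) ⟨⟨E.space.neg_mem (h i).1.1.1, by rw [norm_neg]; exact (h i).1.1.2.1,
    fun j hj => by rw [inner_neg_left, (h i).1.1.2.2 j hj, neg_zero]⟩, (h i).1.2⟩
  rw [inner_neg_left] at this
  linarith

theorem antitone (h : IsPrincipalVectors E F p q) {i j : Fin k} (hij : i ≤ j) :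
    ⟪p j, q j⟫ ≤ ⟪p i, q i⟫ :=
  (h i).2 _ _ ⟨⟨(h j).1.1.1, (h j).1.1.2.1, fun l hl => (h j).1.1.2.2 l (hl.trans_le hij)⟩,
    ⟨(h j).1.2.1, (h j).1.2.2.1, fun l hl => (h j).1.2.2.2 l (hl.trans_le hij)⟩⟩

theorem inner_eq_zero_of_orthogonal (h : IsPrincipalVectors E F p q) (i : Fin k) {v : Euc n}
    (hv : v ∈ E.space) (hvp : ∀ j, j ≤ i → ⟪v, p j⟫ = 0) : ⟪v, q i⟫ = 0 := by
  have hc := h.nonneg i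
  have main : ∀ t : ℝ, ⟪p i, q i⟫ + t * ⟪v, q i⟫ ≤ ⟪p i, q i⟫ * Real.sqrt (1 + t ^ 2 * ‖v‖ ^ 2) := by
    intro t
    set w := p i + t • v with hw
    have hn : ‖w‖ ^ 2 = 1 + t ^ 2 * ‖v‖ ^ 2 := by
      rw [hw, norm_add_sq_real, real_inner_smul_right, real_inner_comm, hvp i le_rfl,
        (h i).1.1.2.1, norm_smul, mul_pow, Real.norm_eq_abs, sq_abs]
      ring
    have hpos : 0 < ‖w‖ := by
      have : 0 < ‖w‖ ^ 2 := by rw [hn]; positivity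
      exact lt_of_le_of_ne (norm_nonneg _) fun h0 => by rw [← h0] at this; norm_num at this
    have hs : Real.sqrt (1 + t ^ 2 * ‖v‖ ^ 2) = ‖w‖ := by
      rw [← hn, Real.sqrt_sq hpos.le]
    have hadm := (h i).2 (‖w‖⁻¹ • w) (q i) ⟨⟨E.space.smul_mem _
      (E.space.add_mem (h i).1.1.1 (E.space.smul_mem _ hv)), by
        rw [norm_smul, norm_inv, norm_norm, inv_mul_cancel₀ hpos.ne'], fun j hj => by
        rw [real_inner_smul_left, hw, inner_add_left, real_inner_smul_left, hvp j hj.le,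
          (h i).1.1.2.2 j hj]; simp⟩, (h i).1.2⟩
    rw [real_inner_smul_left, inv_mul_le_iff₀ hpos] at hadm
    rw [hs, mul_comm _ ‖w‖]
    refine le_trans (le_of_eq ?_) hadm
    rw [hw, inner_add_left, real_inner_smul_left]
  by_contra hne
  set b := ⟪v, q i⟫ with hb
  set c := ⟪p i, q i⟫ with hcdef
  set N := ‖v‖ ^ 2 with hN
  have hN0 : 0 ≤ N := by positivity
  have hb2 : 0 < b ^ 2 := by positivity
  have hden : 0 < c * N + 1 := by positivity
  have h1 := main (b / (c * N + 1))
  have h2 : Real.sqrt (1 + (b / (c * N + 1)) ^ 2 * N) ≤ 1 + (b / (c * N + 1)) ^ 2 * N / 2 := by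
    have h0 : 0 ≤ (b / (c * N + 1)) ^ 2 * N := by positivity
    rw [Real.sqrt_le_left (by positivity)]
    nlinarith [sq_nonneg ((b / (c * N + 1)) ^ 2 * N)]
  have h3 := mul_le_mul_of_nonneg_left h2 hc
  have h4 : b / (c * N + 1) * b ≤ c * ((b / (c * N + 1)) ^ 2 * N / 2) := by linarith
  have h5 : b / (c * N + 1) * b = b ^ 2 / (c * N + 1) := by ring
  have h6 : c * ((b / (c * N + 1)) ^ 2 * N / 2)
      = b ^ 2 / (c * N + 1) * ((c * N) / (2 * (c * N + 1))) := by
    field_simp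
  rw [h5, h6] at h4
  have h7 : 0 < b ^ 2 / (c * N + 1) := by positivity
  have h8 : (c * N) / (2 * (c * N + 1)) < 1 := by
    rw [div_lt_one (by positivity)]
    nlinarith [mul_nonneg hc hN0]
  nlinarith

theorem inner_eq_zero (h : IsPrincipalVectors E F p q) {i j : Fin k} (hij : i ≠ j) :
    ⟪p i, q j⟫ = 0 := by
  rcases lt_or_gt_of_ne hij with hlt | hlt
  · rw [real_inner_comm]
    refine h.symm.inner_eq_zero_of_orthogonal i (h j).1.2.1 fun l hl => ?_
    exact (h j).1.2.2.2 l (hl.trans_lt hlt)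
  · exact h.inner_eq_zero_of_orthogonal j (h i).1.1.1 fun l hl =>
      (h i).1.1.2.2 l (hl.trans_lt hlt)

theorem inner_right_eq (h : IsPrincipalVectors E F p q) (j : Fin k) {x : Euc n}
    (hx : x ∈ E.space) : ⟪x, q j⟫ = ⟪x, p j⟫ * ⟪p j, q j⟫ := by
  have hspan : Submodule.span ℝ (Set.range p) = E.space := by
    refine Submodule.eq_of_le_of_finrank_eq
      (Submodule.span_le.2 (by rintro _ ⟨i, rfl⟩; exact (h i).1.1.1)) ?_
    rw [finrank_span_eq_card h.orthonormal_left.linearIndependent, E.finrank_space,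
      Fintype.card_fin]
  rw [← hspan] at hx
  induction hx using Submodule.span_induction with
  | mem x hx =>
    obtain ⟨i, rfl⟩ := hx
    by_cases hij : i = j
    · subst hij
      rw [real_inner_self_eq_norm_sq, (h i).1.1.2.1]; ring
    · rw [h.inner_eq_zero hij, h.orthonormal_left.2 hij, zero_mul]
  | zero => simp
  | add x y _ _ hx hy => rw [inner_add_left, inner_add_left, hx, hy]; ring
  | smul a x _ hx => rw [real_inner_smul_left, real_inner_smul_left, hx]; ring

theorem inner_le (h : IsPrincipalVectors E F p q) {p' q' : Fin k → Euc n}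
    (h' : IsPrincipalVectors E F p' q') (i : Fin k) : ⟪p' i, q' i⟫ ≤ ⟪p i, q i⟫ := by
  let P' : {j : Fin k // j ≤ i} → Euc n := fun j => p' j.1
  let Q' : {j : Fin k // j ≤ i} → Euc n := fun j => q' j.1
  have hP' : Orthonormal ℝ P' := h'.orthonormal_left.comp _ Subtype.val_injective
  have hQ' : Orthonormal ℝ Q' := h'.symm.orthonormal_left.comp _ Subtype.val_injective
  have hcard : Fintype.card {j : Fin k // j ≤ i} = i + 1 := by
    rw [Fintype.card_subtype]
    have : (Finset.univ.filter fun j : Fin k => j ≤ i) = Finset.Iic i := by ext; simp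
    rw [this, Fin.card_Iic]
  obtain ⟨x, hxS, hx1, hxo⟩ := exists_unit_orthogonal (Submodule.span ℝ (Set.range P')) p i (by
    rw [finrank_span_eq_card hP'.linearIndependent, hcard]; exact Nat.lt_succ_self _)
  have hPE : Submodule.span ℝ (Set.range P') ≤ E.space :=
    Submodule.span_le.2 (by rintro _ ⟨j, rfl⟩; exact (h' j.1).1.1.1)
  have hxE : x ∈ E.space := hPE hxS
  obtain ⟨a, ha⟩ := (Submodule.mem_span_range_iff_exists_fun ℝ).1 hxS
  have hsum : ∑ j, a j ^ 2 = 1 := by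
    have : ⟪x, x⟫ = 1 := by rw [real_inner_self_eq_norm_sq, hx1]; norm_num
    rw [← ha, hP'.inner_sum] at this
    simpa [sq] using this
  -- The orthogonal projection of `x` to `F`.
  set y := F.space.starProjection x with hy
  have hyF : y ∈ F.space := F.space.starProjection_apply_mem x
  have hyin : ∀ z ∈ F.space, ⟪y, z⟫ = ⟪x, z⟫ := by
    intro z hz
    have := F.space.starProjection_inner_eq_zero x z hz
    rw [inner_sub_left] at this
    linarith
  have hinner : ∀ j : {j : Fin k // j ≤ i}, ⟪x, Q' j⟫ = a j * ⟪p' j.1, q' j.1⟫ := by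
    intro j
    have h1 : ⟪x, p' j.1⟫ = a j := by
      have h2 := hP'.inner_left_fintype a j
      rw [ha] at h2
      simpa using h2
    rw [show Q' j = q' j.1 from rfl, h'.inner_right_eq j.1 hxE, h1]
  have hc' := h'.nonneg i
  have hbound : ⟪p' i, q' i⟫ ^ 2 ≤ ‖y‖ ^ 2 := by
    have hb := hQ'.sum_inner_products_le y (s := Finset.univ)
    refine le_trans ?_ hb
    have : ∀ j : {j : Fin k // j ≤ i},
        a j ^ 2 * ⟪p' i, q' i⟫ ^ 2 ≤ ‖⟪Q' j, y⟫‖ ^ 2 := by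
      intro j
      rw [real_inner_comm y (Q' j), hyin (Q' j) (h' j.1).1.2.1, hinner j, Real.norm_eq_abs, sq_abs, mul_pow]
      have := h'.antitone j.2
      gcongr
    calc ⟪p' i, q' i⟫ ^ 2 = ∑ j, a j ^ 2 * ⟪p' i, q' i⟫ ^ 2 := by
          rw [← Finset.sum_mul, hsum, one_mul]
      _ ≤ _ := Finset.sum_le_sum fun j _ => this j
  have hle : ⟪p' i, q' i⟫ ≤ ‖y‖ := by
    exact (pow_le_pow_iff_left₀ hc' (norm_nonneg _) two_ne_zero).1 hbound
  refine hle.trans ?_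
  rcases (norm_nonneg y).eq_or_lt with h0 | hpos
  · rw [← h0]; exact h.nonneg i
  · have hadm := (h i).2 x (‖y‖⁻¹ • y) ⟨⟨hxE, hx1, hxo⟩, ⟨F.space.smul_mem _ hyF, by
      rw [norm_smul, norm_inv, norm_norm, inv_mul_cancel₀ hpos.ne'], fun j hj => by
      rw [real_inner_smul_left, hyin _ (h j).1.2.1, h.inner_right_eq j hxE, hxo j hj]; simp⟩⟩
    refine le_trans (le_of_eq ?_) hadm
    rw [real_inner_smul_right, hyin y hyF |>.symm, real_inner_self_eq_norm_sq]
    field_simp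

end IsPrincipalVectors

theorem principalAngle_eq {k n : ℕ} {E F : Grass k n} {p q : Fin k → Euc n}
    (h : IsPrincipalVectors E F p q) (i : Fin k) :
    principalAngle E F i = Real.arccos ⟪p i, q i⟫ := by
  have h0 := (exists_isPrincipalVectors E F).choose_spec.choose_spec
  unfold principalAngle
  rw [le_antisymm (h.inner_le h0 i) (h0.inner_le h i)]

/-- The Grassmann distance `δ(E,F) = (θ₁² + ⋯ + θ_k²)^{1/2}`, where `θ₁, …, θ_k` are the principal
angles between `E` and `F`. -/
noncomputable def dist {k n : ℕ} (E F : Grass k n) : ℝ :=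
  Real.sqrt (∑ i, principalAngle E F i ^ 2)

/-- The simple Schubert variety `Ω_s(W) = {E | dim (E ∩ W) ≥ s}`. -/
def schubert {k n : ℕ} (W : Grass k n) (s : ℕ) : Set (Grass k n) :=
  {E | s ≤ Module.finrank ℝ (E.space ⊓ W.space : Submodule ℝ (Euc n))}

/-- The planes `L` with `0 < θ₁(L) < ⋯ < θ_k(L) < π/2`, where the `θ_i(L)` are the principal angles
between `L` and `W`. -/
def regularPlanes {k n : ℕ} (W : Grass k n) : Set (Grass k n) :=
  {L | (∀ i, 0 < principalAngle L W i) ∧ StrictMono (principalAngle L W) ∧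
    ∀ i, principalAngle L W i < Real.pi / 2}

/-- The set of global maximizers on `Ω_s(W)` of the distance from `L`. -/
def maximizers {k n : ℕ} (L W : Grass k n) (s : ℕ) : Set (Grass k n) :=
  {E | E ∈ schubert W s ∧ IsMaxOn (fun E' => dist L E') (schubert W s) E}

end Grass

/-! Write `c_i = cos θ_i(L)`. Principal vectors `p`, `q` between `L` and `W` have a diagonal matrix
of inner products with entries `c_i`. Conversely, any orthonormal bases with diagonal, nonnegative,
nonincreasing inner products are principal vectors (`isPrincipalVectors_of_inner_eq_zero`).

Upper bound: if `E` meets `W` in dimension at least `s`, a dimension count in `E ∩ W` gives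
`θ_i(L,E) ≤ θ_{k-s+i}(L,W)` for `i ≤ s` (`inner_le_of_le`), while the other `k-s` angles are at most
`π/2`. Adding `k-s` unit vectors orthogonal to `L` and `E_W` to a basis of `E_W` attains all these
bounds at once.

Equality case: a maximizer attains every bound, so its angles are known and the trace of `P_L P_E`
equals the sum of the last `s` values `c_i²`. Among `s`-dimensional subspaces `V` of `W` this sum is
the least possible trace of `P_L P_V`, attained only at `E_W` because the `c_i` are distinct
(`eq_span_image_last`). Hence an `s`-dimensional `V ≤ E ∩ W` is `E_W` and already carries the whole
trace, which forces the rest of `E` to be orthogonal to `L`.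

Genericity: the `c_i²` are the eigenvalues of the compression of `P_L` to `W`. A Krylov determinant
certifies polynomially that they are distinct and avoid `0` and `1`. One plane passes this test, and
rational curves joining any two planes spread nonvanishing to a dense set
(`dense_eval_coord_ne_zero`). -/

section OrthonormalFamilies

/-! ### Projections and traces through orthonormal families -/

variable {V : Type*} [NormedAddCommGroup V] [InnerProductSpace ℝ V] [FiniteDimensional ℝ V]
  {ι κ : Type*} [Fintype ι] [Fintype κ]

theorem Orthonormal.starProjection_eq_sum_inner {v : ι → V} (hv : Orthonormal ℝ v)
    {S : Submodule ℝ V} (hS : Submodule.span ℝ (Set.range v) = S) (x : V) :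
    S.starProjection x = ∑ i, ⟪v i, x⟫ • v i := by
  classical
  refine Submodule.eq_starProjection_of_mem_of_inner_eq_zero ?_ ?_
  · rw [← hS]
    exact Submodule.sum_mem _ fun i _ =>
      Submodule.smul_mem _ _ (Submodule.subset_span ⟨i, rfl⟩)
  · intro w hw
    rw [← hS] at hw
    induction hw using Submodule.span_induction with
    | mem w hw =>
      obtain ⟨j, rfl⟩ := hw
      have := hv.inner_left_fintype (fun i => ⟪v i, x⟫) j
      rw [inner_sub_left, this, real_inner_comm]
      simp
    | zero => simp
    | add a b _ _ ha hb => rw [inner_add_right, ha, hb, add_zero]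
    | smul c a _ ha => rw [real_inner_smul_right, ha, mul_zero]

theorem Orthonormal.eq_sum_inner {v : ι → V} (hv : Orthonormal ℝ v)
    {S : Submodule ℝ V} (hS : Submodule.span ℝ (Set.range v) = S) {x : V} (hx : x ∈ S) :
    x = ∑ i, ⟪v i, x⟫ • v i := by
  rw [← hv.starProjection_eq_sum_inner hS, Submodule.starProjection_eq_self_iff.2 hx]

theorem Orthonormal.norm_sq_starProjection {v : ι → V} (hv : Orthonormal ℝ v)
    {S : Submodule ℝ V} (hS : Submodule.span ℝ (Set.range v) = S) (x : V) :
    ‖S.starProjection x‖ ^ 2 = ∑ i, ⟪v i, x⟫ ^ 2 := by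
  rw [← real_inner_self_eq_norm_sq, hv.starProjection_eq_sum_inner hS, hv.inner_sum]
  exact Finset.sum_congr rfl fun i _ => by simp [sq]

theorem Orthonormal.norm_sq_eq_sum_inner {v : ι → V} (hv : Orthonormal ℝ v)
    {S : Submodule ℝ V} (hS : Submodule.span ℝ (Set.range v) = S) {x : V} (hx : x ∈ S) :
    ‖x‖ ^ 2 = ∑ i, ⟪v i, x⟫ ^ 2 := by
  rw [← hv.norm_sq_starProjection hS, Submodule.starProjection_eq_self_iff.2 hx]

theorem Orthonormal.inner_eq_sum_inner {v : ι → V} (hv : Orthonormal ℝ v)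
    {S : Submodule ℝ V} (hS : Submodule.span ℝ (Set.range v) = S) {x : V} (hx : x ∈ S) (y : V) :
    ⟪x, y⟫ = ∑ i, ⟪v i, x⟫ * ⟪v i, y⟫ := by
  conv_lhs => rw [hv.eq_sum_inner hS hx]
  rw [sum_inner]
  exact Finset.sum_congr rfl fun i _ => by rw [real_inner_smul_left]

/-- Both sides are the double sum of `⟪u i, v j⟫ ^ 2`, that is, the trace of `P_S P_T`. This makes
the trace computable from either plane. -/
theorem Orthonormal.sum_norm_sq_starProjection_comm {u : ι → V} {v : κ → V}
    (hu : Orthonormal ℝ u) (hv : Orthonormal ℝ v) {S T : Submodule ℝ V}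
    (hS : Submodule.span ℝ (Set.range u) = S) (hT : Submodule.span ℝ (Set.range v) = T) :
    ∑ i, ‖T.starProjection (u i)‖ ^ 2 = ∑ j, ‖S.starProjection (v j)‖ ^ 2 := by
  simp only [hv.norm_sq_starProjection hT, hu.norm_sq_starProjection hS]
  rw [Finset.sum_comm]
  simp only [real_inner_comm]

theorem Submodule.exists_orthonormal_span (S : Submodule ℝ V) {d : ℕ}
    (hd : Module.finrank ℝ S = d) :
    ∃ u : Fin d → V, Orthonormal ℝ u ∧ Submodule.span ℝ (Set.range u) = S := by
  subst hd
  let b := stdOrthonormalBasis ℝ S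
  refine ⟨fun i => b i, b.orthonormal.comp_linearIsometry S.subtypeₗᵢ, ?_⟩
  have h := congrArg (Submodule.map S.subtype) b.toBasis.span_eq
  rw [Submodule.map_span, Submodule.map_top, Submodule.range_subtype, ← Set.range_comp] at h
  simpa [Function.comp_def] using h

/-- Both sides are the trace of `P_T`: after exchanging the roles of the bases, every term is `1`
because `T ≤ S`. -/
theorem Orthonormal.sum_norm_sq_starProjection_eq_finrank {u : ι → V} (hu : Orthonormal ℝ u)
    {S T : Submodule ℝ V} (hS : Submodule.span ℝ (Set.range u) = S) (hTS : T ≤ S) :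
    ∑ i, ‖T.starProjection (u i)‖ ^ 2 = Module.finrank ℝ T := by
  obtain ⟨v, hv, hT⟩ := T.exists_orthonormal_span rfl
  rw [hu.sum_norm_sq_starProjection_comm hv hS hT]
  have : ∀ j, ‖S.starProjection (v j)‖ ^ 2 = 1 := fun j => by
    rw [Submodule.starProjection_eq_self_iff.2 (hTS (hT ▸ Submodule.subset_span ⟨j, rfl⟩)),
      hv.1 j, one_pow]
  simp [this]

theorem Submodule.exists_unit_mem_forall_inner_eq_zero (S : Submodule ℝ V) (u : ι → V)
    (hS : Fintype.card ι < Module.finrank ℝ S) : ∃ x ∈ S, ‖x‖ = 1 ∧ ∀ i, ⟪u i, x⟫ = 0 := by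
  let f : S →ₗ[ℝ] (ι → ℝ) := LinearMap.pi fun i => (innerₛₗ ℝ (u i)).comp S.subtype
  have hker := LinearMap.ker_ne_bot_of_finrank_lt (f := f) (by simpa using hS)
  obtain ⟨z, hz, hz0⟩ := Submodule.exists_mem_ne_zero_of_ne_bot hker
  have hz0' : (z : V) ≠ 0 := by simpa using hz0
  refine ⟨‖(z : V)‖⁻¹ • (z : V), S.smul_mem _ z.2, ?_, fun i => ?_⟩
  · rw [norm_smul, norm_inv, norm_norm, inv_mul_cancel₀ (norm_ne_zero_iff.2 hz0')]
  · have h1 : f z i = 0 := by rw [LinearMap.mem_ker.1 hz]; rfl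
    have h2 : ⟪u i, (z : V)⟫ = 0 := h1
    rw [real_inner_smul_right, h2, mul_zero]

end OrthonormalFamilies

/-! ### Recognizing principal vectors, and interlacing of angles -/

namespace Grass

theorem span_eq_space {k n : ℕ} {E : Grass k n} {p : Fin k → Euc n} (hp : Orthonormal ℝ p)
    (hpE : ∀ i, p i ∈ E.space) : Submodule.span ℝ (Set.range p) = E.space := by
  refine Submodule.eq_of_le_of_finrank_eq
    (Submodule.span_le.2 (by rintro _ ⟨i, rfl⟩; exact hpE i)) ?_
  rw [finrank_span_eq_card hp.linearIndependent, E.finrank_space, Fintype.card_fin]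

theorem principalAngle_nonneg {k n : ℕ} (E F : Grass k n) (i : Fin k) :
    0 ≤ principalAngle E F i := Real.arccos_nonneg _

theorem principalAngle_le_pi_div_two {k n : ℕ} (E F : Grass k n) (i : Fin k) :
    principalAngle E F i ≤ Real.pi / 2 := by
  obtain ⟨p, q, h⟩ := exists_isPrincipalVectors E F
  rw [principalAngle_eq h]
  exact Real.arccos_le_pi_div_two.2 (h.nonneg i)

/-- In the two bases `⟪x, y⟫` is the sum of `c_l x_l y_l`. For an admissible pair at step `i` the
terms with `l < i` vanish, and `c_l ≤ c_i` together with `x_l y_l ≤ (x_l² + y_l²)/2` bounds the rest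
by `c_i`. It lets angles be read off from explicit bases. -/
theorem isPrincipalVectors_of_inner_eq_zero {k n : ℕ} {E F : Grass k n} {p q : Fin k → Euc n}
    (hp : Orthonormal ℝ p) (hq : Orthonormal ℝ q) (hpE : ∀ i, p i ∈ E.space)
    (hqF : ∀ i, q i ∈ F.space) (hpq : ∀ i j, i ≠ j → ⟪p i, q j⟫ = 0)
    (hnonneg : ∀ i, 0 ≤ ⟪p i, q i⟫) (hanti : Antitone fun i => ⟪p i, q i⟫) :
    IsPrincipalVectors E F p q := by
  intro i
  refine ⟨⟨⟨hpE i, hp.1 i, fun j hj => hp.2 hj.ne'⟩, hqF i, hq.1 i, fun j hj => hq.2 hj.ne'⟩, ?_⟩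
  rintro x y ⟨⟨hx, hx1, hxo⟩, hy, hy1, hyo⟩
  have hP := span_eq_space hp hpE
  have hQ := span_eq_space hq hqF
  have hpy : ∀ l, ⟪p l, y⟫ = ⟪p l, q l⟫ * ⟪q l, y⟫ := by
    intro l
    rw [real_inner_comm, hq.inner_eq_sum_inner hQ hy, Finset.sum_eq_single l]
    · rw [real_inner_comm (p l), mul_comm]
    · intro j _ hj
      rw [real_inner_comm (p l) (q j), hpq l j hj.symm, mul_zero]
    · simp
  rw [hp.inner_eq_sum_inner hP hx y]
  have hxs := hp.norm_sq_eq_sum_inner hP hx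
  have hys := hq.norm_sq_eq_sum_inner hQ hy
  rw [hx1] at hxs
  rw [hy1] at hys
  have hterm : ∀ l, ⟪p l, x⟫ * ⟪p l, y⟫ ≤ ⟪p i, q i⟫ * ((⟪p l, x⟫ ^ 2 + ⟪q l, y⟫ ^ 2) / 2) := by
    intro l
    rcases lt_or_ge l i with hl | hl
    · rw [real_inner_comm x (p l), hxo l hl, zero_mul]
      exact mul_nonneg (hnonneg i) (by positivity)
    · rw [hpy l]
      have h1 : ⟪p l, q l⟫ ≤ ⟪p i, q i⟫ := hanti hl
      have h2 : ⟪p l, x⟫ * ⟪q l, y⟫ ≤ (⟪p l, x⟫ ^ 2 + ⟪q l, y⟫ ^ 2) / 2 := by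
        nlinarith [sq_nonneg (⟪p l, x⟫ - ⟪q l, y⟫)]
      calc ⟪p l, x⟫ * (⟪p l, q l⟫ * ⟪q l, y⟫) = ⟪p l, q l⟫ * (⟪p l, x⟫ * ⟪q l, y⟫) := by ring
        _ ≤ ⟪p l, q l⟫ * ((⟪p l, x⟫ ^ 2 + ⟪q l, y⟫ ^ 2) / 2) :=
          mul_le_mul_of_nonneg_left h2 (hnonneg l)
        _ ≤ _ := mul_le_mul_of_nonneg_right h1 (by positivity)
  refine (Finset.sum_le_sum fun l _ => hterm l).trans (le_of_eq ?_)
  rw [← Finset.mul_sum, ← Finset.sum_div, Finset.sum_add_distrib, ← hxs, ← hys]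
  norm_num

namespace IsPrincipalVectors

variable {k n : ℕ} {E F : Grass k n} {p q : Fin k → Euc n}

theorem orthonormal_right (h : IsPrincipalVectors E F p q) : Orthonormal ℝ q :=
  h.symm.orthonormal_left

theorem mem_left (h : IsPrincipalVectors E F p q) (i : Fin k) : p i ∈ E.space := (h i).1.1.1

theorem mem_right (h : IsPrincipalVectors E F p q) (i : Fin k) : q i ∈ F.space := (h i).1.2.1

theorem span_left (h : IsPrincipalVectors E F p q) :
    Submodule.span ℝ (Set.range p) = E.space :=
  span_eq_space h.orthonormal_left h.mem_left

theorem span_right (h : IsPrincipalVectors E F p q) :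
    Submodule.span ℝ (Set.range q) = F.space := h.symm.span_left

theorem inner_le_one (h : IsPrincipalVectors E F p q) (i : Fin k) : ⟪p i, q i⟫ ≤ 1 := by
  refine (real_inner_le_norm _ _).trans ?_
  rw [h.orthonormal_left.1, h.orthonormal_right.1, one_mul]

theorem cos_principalAngle (h : IsPrincipalVectors E F p q) (i : Fin k) :
    Real.cos (principalAngle E F i) = ⟪p i, q i⟫ := by
  rw [principalAngle_eq h, Real.cos_arccos (by linarith [h.nonneg i]) (h.inner_le_one i)]

theorem inner_left_eq (h : IsPrincipalVectors E F p q) (j : Fin k) {y : Euc n}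
    (hy : y ∈ F.space) : ⟪p j, y⟫ = ⟪p j, q j⟫ * ⟪q j, y⟫ := by
  rw [real_inner_comm, h.symm.inner_right_eq j hy, real_inner_comm (p j), real_inner_comm y,
    mul_comm]

theorem starProjection_right (h : IsPrincipalVectors E F p q) (i : Fin k) :
    E.space.starProjection (q i) = ⟪p i, q i⟫ • p i := by
  refine Submodule.eq_starProjection_of_mem_of_inner_eq_zero
    (E.space.smul_mem _ (h.mem_left i)) fun x hx => ?_
  rw [inner_sub_left, real_inner_smul_left, real_inner_comm, h.inner_right_eq i hx,
    real_inner_comm x]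
  ring

theorem norm_sq_starProjection (h : IsPrincipalVectors E F p q) {y : Euc n} (hy : y ∈ F.space) :
    ‖E.space.starProjection y‖ ^ 2 = ∑ i, ⟪p i, q i⟫ ^ 2 * ⟪q i, y⟫ ^ 2 := by
  rw [h.orthonormal_left.norm_sq_starProjection h.span_left]
  exact Finset.sum_congr rfl fun i _ => by rw [h.inner_left_eq i hy, mul_pow]

theorem norm_sq_starProjection_right (h : IsPrincipalVectors E F p q) (i : Fin k) :
    ‖E.space.starProjection (q i)‖ ^ 2 = ⟪p i, q i⟫ ^ 2 := by
  rw [h.starProjection_right, norm_smul, h.orthonormal_left.1, mul_one, Real.norm_eq_abs, sq_abs]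

/-- Interlacing: if `E` and `W` share an `s`-dimensional subspace, then
`θ_i(L, E) ≤ θ_{k-s+i}(L, W)` for `i ≤ s`, stated through the cosines. -/
theorem inner_le_of_le {L W : Grass k n} {p' q' : Fin k → Euc n}
    (h : IsPrincipalVectors L W p q) (h' : IsPrincipalVectors L E p' q')
    {V : Submodule ℝ (Euc n)} (hVE : V ≤ E.space) (hVW : V ≤ W.space) {i j : Fin k}
    (hij : k + i ≤ Module.finrank ℝ V + j) : ⟪p j, q j⟫ ≤ ⟪p' i, q' i⟫ := by
  -- There are `(k - 1 - j) + i` linear conditions, fewer than `dim V` by `hij`. For the resulting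
  -- `x`, the squared norm of its projection to `L` is a weighted mean of squared cosines: at least
  -- the `j`-th one when expanded in `W`, at most the `i`-th one when expanded in `E`.
  obtain ⟨x, hxV, hx1, hxo⟩ := V.exists_unit_mem_forall_inner_eq_zero
    (Sum.elim (fun l : Finset.Ioi j => q l) (fun l : Finset.Iio i => q' l)) (by
      rw [Fintype.card_sum, Fintype.card_coe, Fintype.card_coe, Fin.card_Ioi, Fin.card_Iio]
      have := j.2
      omega)
  have hq : ∀ l, j < l → ⟪q l, x⟫ = 0 := fun l hl => hxo (Sum.inl ⟨l, Finset.mem_Ioi.2 hl⟩)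
  have hq' : ∀ l, l < i → ⟪q' l, x⟫ = 0 := fun l hl => hxo (Sum.inr ⟨l, Finset.mem_Iio.2 hl⟩)
  have h1 : ⟪p j, q j⟫ ^ 2 ≤ ‖L.space.starProjection x‖ ^ 2 := by
    rw [h.norm_sq_starProjection (hVW hxV)]
    calc ⟪p j, q j⟫ ^ 2 = ∑ l, ⟪p j, q j⟫ ^ 2 * ⟪q l, x⟫ ^ 2 := by
          rw [← Finset.mul_sum, ← h.orthonormal_right.norm_sq_eq_sum_inner h.span_right (hVW hxV),
            hx1]; ring
      _ ≤ _ := Finset.sum_le_sum fun l _ => by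
          rcases lt_or_ge j l with hl | hl
          · rw [hq l hl]; simp
          · have := h.antitone hl
            have := h.nonneg j
            gcongr
  have h2 : ‖L.space.starProjection x‖ ^ 2 ≤ ⟪p' i, q' i⟫ ^ 2 := by
    rw [h'.norm_sq_starProjection (hVE hxV)]
    calc _ ≤ ∑ l, ⟪p' i, q' i⟫ ^ 2 * ⟪q' l, x⟫ ^ 2 := Finset.sum_le_sum fun l _ => by
          rcases lt_or_ge l i with hl | hl
          · rw [hq' l hl]; simp
          · have := h'.antitone hl
            have := h'.nonneg l
            gcongr
      _ = ⟪p' i, q' i⟫ ^ 2 := by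
          rw [← Finset.mul_sum,
            ← h'.orthonormal_right.norm_sq_eq_sum_inner h'.span_right (hVE hxV), hx1]; ring
  exact (pow_le_pow_iff_left₀ (h.nonneg j) (h'.nonneg i) two_ne_zero).1 (h1.trans h2)

end IsPrincipalVectors

end Grass

/-! ### Subspaces of given dimension, and the cyclic shift of indices -/

theorem Submodule.exists_le_finrank_eq {V : Type*} [AddCommGroup V] [Module ℝ V]
    (S : Submodule ℝ V) {d : ℕ} (hd : d ≤ Module.finrank ℝ S) :
    ∃ T ≤ S, Module.finrank ℝ T = d := by
  obtain ⟨f, hf⟩ := exists_linearIndependent_of_le_finrank hd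
  have hf' : LinearIndependent ℝ (fun i => (f i : V)) := hf.map' S.subtype S.ker_subtype
  refine ⟨span ℝ (Set.range fun i => (f i : V)),
    span_le.2 (by rintro _ ⟨i, rfl⟩; exact (f i).2), ?_⟩
  rw [finrank_span_eq_card hf', Fintype.card_fin]

/-- The cyclic permutation of `Fin k` that moves the last `s` indices to the front. -/
def Fin.lastToFront {k s : ℕ} (hsk : s ≤ k) : Equiv.Perm (Fin k) where
  toFun i := ⟨if i.val < s then i.val + (k - s) else i.val - s, by
    have := i.2; split_ifs <;> omega⟩
  invFun i := ⟨if k - s ≤ i.val then i.val - (k - s) else i.val + s, by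
    have := i.2; split_ifs <;> omega⟩
  left_inv i := by
    ext; have := i.2; dsimp only; split_ifs <;> omega
  right_inv i := by
    ext; have := i.2; dsimp only; split_ifs <;> omega

theorem Fin.val_lastToFront {k s : ℕ} (hsk : s ≤ k) (i : Fin k) :
    (Fin.lastToFront hsk i).val = if i.val < s then i.val + (k - s) else i.val - s := rfl

theorem Fin.sub_le_lastToFront_iff {k s : ℕ} (hsk : s ≤ k) (i : Fin k) :
    k - s ≤ (Fin.lastToFront hsk i).val ↔ i.val < s := by
  rw [Fin.val_lastToFront]
  have := i.2
  split_ifs <;> omega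

theorem Fin.card_filter_not_le {k m : ℕ} (hm : m ≤ k) :
    (Finset.univ.filter fun i : Fin k => ¬ m ≤ i.val).card = m := by
  rw [Finset.filter_congr (q := fun i : Fin k => i.val < m) (fun i _ => by omega),
    Fin.card_filter_val_lt, min_eq_right hm]

theorem Fin.card_filter_sub_le {k s : ℕ} (hsk : s ≤ k) :
    (Finset.univ.filter fun i : Fin k => k - s ≤ i.val).card = s := by
  have h := Finset.card_filter_add_card_filter_not (s := Finset.univ)
    (fun i : Fin k => k - s ≤ i.val)
  rw [Fin.card_filter_not_le (Nat.sub_le k s), Finset.card_univ, Fintype.card_fin] at h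
  omega

/-! ### The upper bound for the distance on the Schubert variety -/

namespace Grass

variable {k n s : ℕ}

/-- The angles `θ_i(L, W)` for the last `s` indices, and `π/2` for the others: up to order, the
principal angles between `L` and a point of `Ω_s(W)` that is farthest from `L`. -/
noncomputable def farAngle (L W : Grass k n) (s : ℕ) (i : Fin k) : ℝ :=
  if k - s ≤ i.val then principalAngle L W i else Real.pi / 2

theorem farAngle_nonneg (L W : Grass k n) (s : ℕ) (i : Fin k) : 0 ≤ farAngle L W s i := by
  unfold farAngle
  split_ifs
  · exact principalAngle_nonneg L W i
  · positivity

theorem sum_farAngle_sq (hsk : s ≤ k) (L W : Grass k n) :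
    ∑ i, farAngle L W s (Fin.lastToFront hsk i) ^ 2 =
      (∑ i : Fin k with k - s ≤ i.val, principalAngle L W i ^ 2)
        + ((k - s : ℕ) : ℝ) * (Real.pi / 2) ^ 2 := by
  rw [Equiv.sum_comp (Fin.lastToFront hsk) fun i => farAngle L W s i ^ 2,
    ← Finset.sum_filter_add_sum_filter_not _ (fun i : Fin k => k - s ≤ i.val)]
  congr 1
  · refine Finset.sum_congr rfl fun i hi => ?_
    rw [farAngle, if_pos (Finset.mem_filter.1 hi).2]
  · rw [Finset.sum_congr rfl (g := fun _ => (Real.pi / 2) ^ 2) fun i hi => by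
      rw [farAngle, if_neg (Finset.mem_filter.1 hi).2], Finset.sum_const,
      Fin.card_filter_not_le (Nat.sub_le k s), nsmul_eq_mul]

/-- For `i < s` this is interlacing with the common subspace `E ∩ W` and `j = i + (k - s)`; the
remaining far angles are `π/2`. The shift lists the far angles in increasing order, `π/2` last, to
match the sorted angles of `E`. -/
theorem principalAngle_le_farAngle (hsk : s ≤ k) (L W : Grass k n) {E : Grass k n}
    (hE : E ∈ schubert W s) (i : Fin k) :
    principalAngle L E i ≤ farAngle L W s (Fin.lastToFront hsk i) := by
  unfold farAngle
  split_ifs with hi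
  · obtain ⟨p, q, h⟩ := exists_isPrincipalVectors L W
    obtain ⟨p', q', h'⟩ := exists_isPrincipalVectors L E
    rw [principalAngle_eq h, principalAngle_eq h']
    refine Real.arccos_le_arccos (h.inner_le_of_le h' inf_le_left inf_le_right ?_)
    have hi' := (Fin.sub_le_lastToFront_iff hsk i).1 hi
    rw [Fin.val_lastToFront, if_pos hi']
    have : s ≤ Module.finrank ℝ (E.space ⊓ W.space : Submodule ℝ (Euc n)) := hE
    omega
  · exact principalAngle_le_pi_div_two L E i

theorem dist_le_of_mem_schubert (hsk : s ≤ k) (L W : Grass k n) {E : Grass k n}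
    (hE : E ∈ schubert W s) :
    dist L E ≤ Real.sqrt ((∑ i : Fin k with k - s ≤ i.val, principalAngle L W i ^ 2)
        + ((k - s : ℕ) : ℝ) * (Real.pi / 2) ^ 2) := by
  rw [← sum_farAngle_sq hsk]
  refine Real.sqrt_le_sqrt (Finset.sum_le_sum fun i _ => ?_)
  exact pow_le_pow_left₀ (principalAngle_nonneg L E i) (principalAngle_le_farAngle hsk L W hE i) 2

/-- The bound holds term by term, so equality of the sums of squares forces equality of every term.
-/
theorem principalAngle_eq_farAngle (hsk : s ≤ k) {L W E : Grass k n} (hE : E ∈ schubert W s)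
    (hd : dist L E = Real.sqrt ((∑ i : Fin k with k - s ≤ i.val, principalAngle L W i ^ 2)
        + ((k - s : ℕ) : ℝ) * (Real.pi / 2) ^ 2)) (i : Fin k) :
    principalAngle L E i = farAngle L W s (Fin.lastToFront hsk i) := by
  rw [← sum_farAngle_sq hsk, dist, Real.sqrt_inj (by positivity) (by positivity)] at hd
  have h := (Finset.sum_eq_sum_iff_of_le (fun i _ =>
    pow_le_pow_left₀ (principalAngle_nonneg L E i)
      (principalAngle_le_farAngle hsk L W hE i) 2)).1 hd i (Finset.mem_univ i)
  exact (pow_left_inj₀ (principalAngle_nonneg L E i) (farAngle_nonneg L W s _) two_ne_zero).1 h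

/-! ### The planes that attain the bound -/

section FarPlanes

variable {L W : Grass k n} {p q : Fin k → Euc n}

theorem finrank_span_image_last (hsk : s ≤ k) (h : IsPrincipalVectors L W p q) :
    Module.finrank ℝ (Submodule.span ℝ (q '' {i : Fin k | k - s ≤ i.val})) = s := by
  have hli : LinearIndependent ℝ (fun i : {i : Fin k | k - s ≤ i.val} => q i) :=
    h.orthonormal_right.linearIndependent.comp _ Subtype.val_injective
  rw [Set.image_eq_range, finrank_span_eq_card hli]
  exact (Fintype.card_subtype _).trans (Fin.card_filter_sub_le hsk)

theorem span_image_last_le (h : IsPrincipalVectors L W p q) :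
    Submodule.span ℝ (q '' {i : Fin k | k - s ≤ i.val}) ≤ W.space :=
  Submodule.span_le.2 (by rintro _ ⟨i, -, rfl⟩; exact h.mem_right i)

theorem IsPrincipalVectors.strictAnti (h : IsPrincipalVectors L W p q)
    (hL : L ∈ regularPlanes W) {i j : Fin k} (hij : i < j) : ⟪p j, q j⟫ < ⟪p i, q i⟫ := by
  refine lt_of_le_of_ne (h.antitone hij.le) fun heq => ?_
  have := hL.2.1 hij
  rw [principalAngle_eq h, principalAngle_eq h, heq] at this
  exact lt_irrefl _ this

theorem IsPrincipalVectors.inner_lt_one (h : IsPrincipalVectors L W p q)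
    (hL : L ∈ regularPlanes W) (i : Fin k) : ⟪p i, q i⟫ < 1 := by
  have := hL.1 i
  rw [principalAngle_eq h, Real.arccos_pos] at this
  exact this

/-- For `x` in both planes, passing from `q i` to `p i` and back gives `⟪q i, x⟫ = c_i² ⟪q i, x⟫`,
and `c_i < 1`. -/
theorem inf_eq_bot_of_mem_regularPlanes (hL : L ∈ regularPlanes W) : L.space ⊓ W.space = ⊥ := by
  obtain ⟨p, q, h⟩ := exists_isPrincipalVectors L W
  rw [eq_bot_iff]
  rintro x ⟨hxL, hxW⟩
  have h1 : ∀ i, ⟪q i, x⟫ = 0 := by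
    intro i
    have e1 := h.inner_left_eq i hxW
    have e2 := h.inner_right_eq i hxL
    rw [real_inner_comm, real_inner_comm (p i), e1] at e2
    have hc := h.inner_lt_one hL i
    have hc0 := h.nonneg i
    have hne : 1 - ⟪p i, q i⟫ * ⟪p i, q i⟫ ≠ 0 := by nlinarith
    have : ⟪q i, x⟫ * (1 - ⟪p i, q i⟫ * ⟪p i, q i⟫) = 0 := by linarith
    exact (mul_eq_zero.1 this).resolve_right hne
  rw [Submodule.mem_bot, h.orthonormal_right.eq_sum_inner h.span_right hxW]
  simp [h1]

theorem notMem_schubert_of_mem_regularPlanes (hs1 : 1 ≤ s) (hL : L ∈ regularPlanes W) :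
    L ∉ schubert W s := by
  intro hmem
  have h2 : s ≤ Module.finrank ℝ (L.space ⊓ W.space : Submodule ℝ (Euc n)) := hmem
  rw [inf_eq_bot_of_mem_regularPlanes hL, finrank_bot] at h2
  omega

/-- The sum `L ⊔ V` is direct, since `L` meets `W` trivially, and the subspace in question is its
orthogonal complement. -/
theorem finrank_orthogonal_inf_orthogonal (hL : L ∈ regularPlanes W)
    {V : Submodule ℝ (Euc n)} (hVW : V ≤ W.space) (hV : Module.finrank ℝ V = s) :
    Module.finrank ℝ (L.spaceᗮ ⊓ Vᗮ : Submodule ℝ (Euc n)) = n - k - s := by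
  have h1 : L.space ⊓ V = ⊥ :=
    eq_bot_iff.2 ((inf_le_inf_left _ hVW).trans (inf_eq_bot_of_mem_regularPlanes hL).le)
  have h2 := Submodule.finrank_sup_add_finrank_inf_eq L.space V
  have h3 := Submodule.finrank_add_finrank_orthogonal (L.space ⊔ V)
  rw [h1, finrank_bot, L.finrank_space, hV] at h2
  rw [finrank_euclideanSpace_fin] at h3
  rw [Submodule.inf_orthogonal]
  omega

/-- Among the `s`-dimensional subspaces `V` of `W`, the span of the last `s` principal vectors
uniquely minimizes the trace of the compression to `V` of the projection onto `L`. -/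
theorem eq_span_image_last (hsk : s ≤ k) (h : IsPrincipalVectors L W p q)
    (hL : L ∈ regularPlanes W) {V : Submodule ℝ (Euc n)} (hVW : V ≤ W.space)
    (hV : Module.finrank ℝ V = s)
    (hT : ∑ i, ‖V.starProjection (p i)‖ ^ 2 ≤
      ∑ i : Fin k with k - s ≤ i.val, ⟪p i, q i⟫ ^ 2) :
    V = Submodule.span ℝ (q '' {i : Fin k | k - s ≤ i.val}) ∧
      ∑ i, ‖V.starProjection (p i)‖ ^ 2 = ∑ i : Fin k with k - s ≤ i.val, ⟪p i, q i⟫ ^ 2 := by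
  -- For `s = 0` the threshold index `k - s` used below is not an element of `Fin k`.
  rcases Nat.eq_zero_or_pos s with hs0 | hs0
  · subst hs0
    have hV0 : V = ⊥ := Submodule.finrank_eq_zero.1 hV
    subst hV0
    have hemp : {i : Fin k | k - 0 ≤ i.val} = ∅ := by
      ext i; have := i.2; simp
    have hemp' : (Finset.univ.filter fun i : Fin k => k - 0 ≤ i.val) = ∅ := by
      ext i; have := i.2; simp
    rw [hemp, hemp']
    simp
  -- The trace is the sum of `c_i² w_i` with weights `0 ≤ w_i ≤ 1` of total `s`. Since the `c_i²`
  -- decrease, it is least when all the weight lies on the last `s` indices, as in the indicator `e`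
  -- below.
  set w : Fin k → ℝ := fun i => ‖V.starProjection (q i)‖ ^ 2 with hw
  have hw1 : ∀ i, w i ≤ 1 := fun i => by
    have := V.norm_starProjection_apply_le (q i)
    rw [h.orthonormal_right.1] at this
    exact pow_le_one₀ (norm_nonneg _) this
  have hw0 : ∀ i, 0 ≤ w i := fun i => by positivity
  have hws : ∑ i, w i = s := by
    rw [h.orthonormal_right.sum_norm_sq_starProjection_eq_finrank h.span_right hVW, hV]
  have hTw : ∀ i, ‖V.starProjection (p i)‖ ^ 2 = ⟪p i, q i⟫ ^ 2 * w i := by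
    intro i
    have e := Submodule.starProjection_comp_starProjection_of_le hVW
    have e' : V.starProjection (p i) = V.starProjection (W.space.starProjection (p i)) := by
      rw [← ContinuousLinearMap.comp_apply, e]
    rw [e', h.symm.starProjection_right, map_smul, norm_smul, mul_pow, Real.norm_eq_abs, sq_abs,
      real_inner_comm]
  simp only [hTw] at hT ⊢
  let a : Fin k := ⟨k - s, by omega⟩
  set e : Fin k → ℝ := fun i => if k - s ≤ i.val then 1 else 0 with he
  have hes : ∑ i, e i = s := by
    simp only [he, Finset.sum_boole]
    rw [Fin.card_filter_sub_le hsk]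
  have hce : ∑ i : Fin k with k - s ≤ i.val, ⟪p i, q i⟫ ^ 2 = ∑ i, ⟪p i, q i⟫ ^ 2 * e i := by
    simp only [he, mul_ite, mul_one, mul_zero, Finset.sum_filter]
  rw [hce] at hT ⊢
  -- Subtracting the threshold value `c_a²` changes nothing in the sum, as `w` and `e` have equal
  -- totals, and it makes both factors of each term have the same sign.
  have hterm : ∀ i, 0 ≤ (⟪p i, q i⟫ ^ 2 - ⟪p a, q a⟫ ^ 2) * (w i - e i) := by
    intro i
    by_cases hi : k - s ≤ i.val
    · have h1 : ⟪p i, q i⟫ ^ 2 ≤ ⟪p a, q a⟫ ^ 2 :=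
        pow_le_pow_left₀ (h.nonneg i) (h.antitone (i := a) hi) 2
      have h2 : e i = 1 := if_pos hi
      exact mul_nonneg_of_nonpos_of_nonpos (by linarith) (by linarith [hw1 i])
    · have h1 : ⟪p a, q a⟫ ^ 2 ≤ ⟪p i, q i⟫ ^ 2 :=
        pow_le_pow_left₀ (h.nonneg a) (h.antitone (i := i) (j := a) (Fin.le_def.2
          (not_le.1 hi).le)) 2
      have h2 : e i = 0 := if_neg hi
      exact mul_nonneg (by linarith) (by linarith [hw0 i])
  have hsum : ∑ i, (⟪p i, q i⟫ ^ 2 - ⟪p a, q a⟫ ^ 2) * (w i - e i)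
      = ∑ i, ⟪p i, q i⟫ ^ 2 * w i - ∑ i, ⟪p i, q i⟫ ^ 2 * e i := by
    have : ∀ i, (⟪p i, q i⟫ ^ 2 - ⟪p a, q a⟫ ^ 2) * (w i - e i) =
        (⟪p i, q i⟫ ^ 2 * w i - ⟪p i, q i⟫ ^ 2 * e i)
          - (⟪p a, q a⟫ ^ 2 * w i - ⟪p a, q a⟫ ^ 2 * e i) := fun i => by ring
    simp only [this, Finset.sum_sub_distrib, ← Finset.mul_sum, hws, hes]
    ring
  have hzero : ∑ i, (⟪p i, q i⟫ ^ 2 - ⟪p a, q a⟫ ^ 2) * (w i - e i) = 0 :=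
    le_antisymm (by rw [hsum]; linarith) (Finset.sum_nonneg fun i _ => hterm i)
  refine ⟨?_, by linarith [hsum.symm.trans hzero]⟩
  -- Every term now vanishes, and before the threshold the first factor is positive by strict
  -- monotonicity of the angles.
  have hw_zero : ∀ i : Fin k, ¬ k - s ≤ i.val → V.starProjection (q i) = 0 := by
    intro i hi
    have h1 := (Finset.sum_eq_zero_iff_of_nonneg fun i _ => hterm i).1 hzero i (Finset.mem_univ i)
    have h2 : e i = 0 := if_neg hi
    have h3 : ⟪p a, q a⟫ ^ 2 < ⟪p i, q i⟫ ^ 2 :=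
      pow_lt_pow_left₀ (h.strictAnti hL (i := i) (j := a) (Fin.lt_def.2 (not_le.1 hi)))
        (h.nonneg a) two_ne_zero
    rw [h2, sub_zero] at h1
    have h4 : w i = 0 := (mul_eq_zero.1 h1).resolve_left (by linarith)
    exact norm_eq_zero.1 (pow_eq_zero_iff two_ne_zero |>.1 h4)
  refine Submodule.eq_of_le_of_finrank_eq (fun x hx => ?_)
    (by rw [hV, finrank_span_image_last hsk h])
  rw [h.orthonormal_right.eq_sum_inner h.span_right (hVW hx)]
  refine Submodule.sum_mem _ fun i _ => ?_
  by_cases hi : k - s ≤ i.val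
  · exact Submodule.smul_mem _ _ (Submodule.subset_span ⟨i, hi, rfl⟩)
  · have : ⟪q i, x⟫ = 0 := by
      have := V.starProjection_inner_eq_zero (q i) x hx
      rwa [hw_zero i hi, sub_zero] at this
    rw [this, zero_smul]
    exact Submodule.zero_mem _

/-- The known angles determine the trace of `P_L P_E`, which the trace for `V ≤ E ∩ W` cannot
exceed. Minimality then gives `V = E_W` and equal traces, so `P_E` maps `L` into `V`; hence the
complement of `V` in `E` is orthogonal to `L` and serves as `B`. -/
theorem exists_eq_sup_of_dist_eq (hsk : s ≤ k) (h : IsPrincipalVectors L W p q)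
    (hL : L ∈ regularPlanes W) {E : Grass k n} (hE : E ∈ schubert W s)
    (hd : dist L E = Real.sqrt ((∑ i : Fin k with k - s ≤ i.val, principalAngle L W i ^ 2)
        + ((k - s : ℕ) : ℝ) * (Real.pi / 2) ^ 2)) :
    ∃ B : Submodule ℝ (Euc n),
      B ≤ L.spaceᗮ ⊓ (Submodule.span ℝ (q '' {i : Fin k | k - s ≤ i.val}))ᗮ ∧
      Module.finrank ℝ B = k - s ∧
      E.space = B ⊔ Submodule.span ℝ (q '' {i : Fin k | k - s ≤ i.val}) := by
  obtain ⟨p', q', h'⟩ := exists_isPrincipalVectors L E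
  -- The intersection could have dimension above `s`, so a subspace of dimension exactly `s` is
  -- chosen.
  obtain ⟨V, hV, hVs⟩ := (E.space ⊓ W.space).exists_le_finrank_eq hE
  have hVE := hV.trans inf_le_left
  have hVW := hV.trans inf_le_right
  -- The angles equal to `π/2` contribute nothing to the trace.
  have hTE : ∑ i, ‖E.space.starProjection (p i)‖ ^ 2
      = ∑ i : Fin k with k - s ≤ i.val, ⟪p i, q i⟫ ^ 2 := by
    rw [h.orthonormal_left.sum_norm_sq_starProjection_comm h'.orthonormal_right h.span_left
      h'.span_right]
    simp only [h'.norm_sq_starProjection_right, ← h'.cos_principalAngle,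
      principalAngle_eq_farAngle hsk hE hd]
    rw [Equiv.sum_comp (Fin.lastToFront hsk) fun i => Real.cos (farAngle L W s i) ^ 2,
      Finset.sum_filter]
    refine Finset.sum_congr rfl fun i _ => ?_
    unfold farAngle
    split_ifs
    · rw [h.cos_principalAngle]
    · rw [Real.cos_pi_div_two]; norm_num
  have hle : ∀ i, ‖V.starProjection (p i)‖ ^ 2 ≤ ‖E.space.starProjection (p i)‖ ^ 2 := by
    intro i
    have e := Submodule.starProjection_comp_starProjection_of_le hVE
    rw [← e, ContinuousLinearMap.comp_apply]
    exact pow_le_pow_left₀ (norm_nonneg _) (V.norm_starProjection_apply_le _) 2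
  obtain ⟨hVeq, hTV⟩ := eq_span_image_last hsk h hL hVW hVs
    ((Finset.sum_le_sum fun i _ => hle i).trans hTE.le)
  -- Projecting `P_E (p i)` further to `V` preserves its norm, so this vector already lies in `V`.
  have hmem : ∀ i, E.space.starProjection (p i) ∈ V := by
    intro i
    have h1 := (Finset.sum_eq_sum_iff_of_le fun i _ => hle i).1 (hTV.trans hTE.symm) i
      (Finset.mem_univ i)
    rw [Submodule.mem_iff_norm_starProjection, ← ContinuousLinearMap.comp_apply,
      Submodule.starProjection_comp_starProjection_of_le hVE]
    exact (pow_left_inj₀ (norm_nonneg _) (norm_nonneg _) two_ne_zero).1 h1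
  rw [← hVeq]
  have hsup : E.space = (E.space ⊓ Vᗮ) ⊔ V := by
    rw [sup_comm, inf_comm]
    exact (Submodule.sup_orthogonal_inf_of_hasOrthogonalProjection hVE).symm
  refine ⟨E.space ⊓ Vᗮ, le_inf (fun b hb => ?_) inf_le_right, ?_, hsup⟩
  · rw [Submodule.mem_orthogonal]
    intro x hx
    rw [h.orthonormal_left.inner_eq_sum_inner h.span_left hx]
    refine Finset.sum_eq_zero fun i _ => ?_
    have h1 := E.space.starProjection_inner_eq_zero (p i) b hb.1
    rw [inner_sub_left, hb.2 _ (hmem i), sub_zero] at h1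
    rw [h1, mul_zero]
  · have h1 := Submodule.finrank_sup_add_finrank_inf_eq (E.space ⊓ Vᗮ) V
    have h2 : E.space ⊓ Vᗮ ⊓ V = ⊥ := by
      rw [inf_assoc, inf_comm Vᗮ, V.inf_orthogonal_eq_bot, inf_bot_eq]
    rw [h2, ← hsup, finrank_bot, E.finrank_space, hVs] at h1
    omega

/-- Replacing the first `k - s` vectors `q i` by an orthonormal basis of `B` keeps the inner
products with `p` diagonal, with zeros in the replaced places. Reordered, these bases are principal
vectors. -/
theorem mem_schubert_and_dist_eq_of_eq_sup (hsk : s ≤ k) (h : IsPrincipalVectors L W p q)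
    {B : Submodule ℝ (Euc n)}
    (hB : B ≤ L.spaceᗮ ⊓ (Submodule.span ℝ (q '' {i : Fin k | k - s ≤ i.val}))ᗮ)
    (hBs : Module.finrank ℝ B = k - s) {E : Grass k n}
    (hE : E.space = B ⊔ Submodule.span ℝ (q '' {i : Fin k | k - s ≤ i.val})) :
    E ∈ schubert W s ∧
    dist L E = Real.sqrt ((∑ i : Fin k with k - s ≤ i.val, principalAngle L W i ^ 2)
        + ((k - s : ℕ) : ℝ) * (Real.pi / 2) ^ 2) := by
  refine ⟨?_, ?_⟩
  · have := Submodule.finrank_mono (le_inf (hE ▸ le_sup_right) (span_image_last_le h) :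
      Submodule.span ℝ (q '' {i : Fin k | k - s ≤ i.val}) ≤ E.space ⊓ W.space)
    rwa [finrank_span_image_last hsk h] at this
  obtain ⟨b, hb, hbB⟩ := B.exists_orthonormal_span hBs
  have hbmem : ∀ i, b i ∈ B := fun i => hbB ▸ Submodule.subset_span ⟨i, rfl⟩
  have hqmem : ∀ i : Fin k, k - s ≤ i.val →
      q i ∈ Submodule.span ℝ (q '' {i : Fin k | k - s ≤ i.val}) :=
    fun i hi => Submodule.subset_span ⟨i, hi, rfl⟩
  have hqb : ∀ (i : Fin k) (j : Fin (k - s)), k - s ≤ i.val → ⟪q i, b j⟫ = 0 :=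
    fun i j hi => (hB (hbmem j)).2 _ (hqmem i hi)
  have hpb : ∀ (i : Fin k) (j : Fin (k - s)), ⟪p i, b j⟫ = 0 :=
    fun i j => (hB (hbmem j)).1 _ (h.mem_left i)
  let r : Fin k → Euc n := fun i => if hi : k - s ≤ i.val then q i else b ⟨i, not_le.1 hi⟩
  have hr_pos : ∀ i : Fin k, k - s ≤ i.val → r i = q i := fun i hi => dif_pos hi
  have hr_neg : ∀ (i : Fin k) (hi : ¬ k - s ≤ i.val), r i = b ⟨i, not_le.1 hi⟩ :=
    fun i hi => dif_neg hi
  have hr : Orthonormal ℝ r := by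
    refine ⟨fun i => ?_, fun i j hij => ?_⟩
    · by_cases hi : k - s ≤ i.val
      · rw [hr_pos i hi, h.orthonormal_right.1]
      · rw [hr_neg i hi, hb.1]
    · show ⟪r i, r j⟫ = 0
      by_cases hi : k - s ≤ i.val <;> by_cases hj : k - s ≤ j.val
      · rw [hr_pos i hi, hr_pos j hj, h.orthonormal_right.2 hij]
      · rw [hr_pos i hi, hr_neg j hj, hqb i _ hi]
      · rw [hr_neg i hi, hr_pos j hj, real_inner_comm, hqb j _ hj]
      · rw [hr_neg i hi, hr_neg j hj]
        exact hb.2 fun heq => hij (Fin.ext (by simpa using heq))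
  have hrE : ∀ i, r i ∈ E.space := by
    intro i
    rw [hE]
    by_cases hi : k - s ≤ i.val
    · rw [hr_pos i hi]; exact Submodule.mem_sup_right (hqmem i hi)
    · rw [hr_neg i hi]; exact Submodule.mem_sup_left (hbmem _)
  have hpr : ∀ i j, i ≠ j → ⟪p i, r j⟫ = 0 := by
    intro i j hij
    by_cases hj : k - s ≤ j.val
    · rw [hr_pos j hj, h.inner_eq_zero hij]
    · rw [hr_neg j hj, hpb]
  have hdiag : ∀ i, ⟪p i, r i⟫ = Real.cos (farAngle L W s i) := by
    intro i
    by_cases hi : k - s ≤ i.val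
    · rw [hr_pos i hi, farAngle, if_pos hi, h.cos_principalAngle]
    · rw [hr_neg i hi, farAngle, if_neg hi, hpb, Real.cos_pi_div_two]
  have hdiag0 : ∀ i, 0 ≤ ⟪p i, r i⟫ := by
    intro i
    by_cases hi : k - s ≤ i.val
    · rw [hr_pos i hi]; exact h.nonneg i
    · rw [hr_neg i hi, hpb]
  -- The cosines of `r` start with the zeros from `B`; the shift moves these to the end, so that the
  -- cosines are nonincreasing.
  have hPV : IsPrincipalVectors L E (p ∘ Fin.lastToFront hsk) (r ∘ Fin.lastToFront hsk) := by
    refine isPrincipalVectors_of_inner_eq_zero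
      (h.orthonormal_left.comp _ (Fin.lastToFront hsk).injective)
      (hr.comp _ (Fin.lastToFront hsk).injective) (fun i => h.mem_left _) (fun i => hrE _)
      (fun i j hij => hpr _ _ fun heq => hij ((Fin.lastToFront hsk).injective heq))
      (fun i => hdiag0 _) fun i j hij => ?_
    dsimp only [Function.comp_apply]
    by_cases hj : k - s ≤ (Fin.lastToFront hsk j).val
    · have hj' := (Fin.sub_le_lastToFront_iff hsk j).1 hj
      have hi' : i.val < s := lt_of_le_of_lt hij hj'
      rw [hr_pos _ hj, hr_pos _ ((Fin.sub_le_lastToFront_iff hsk i).2 hi')]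
      refine h.antitone ?_
      rw [Fin.le_def, Fin.val_lastToFront, Fin.val_lastToFront, if_pos hi', if_pos hj']
      exact Nat.add_le_add_right hij _
    · rw [hr_neg _ hj, hpb]
      exact hdiag0 _
  rw [← sum_farAngle_sq hsk, dist]
  congr 1
  refine Finset.sum_congr rfl fun i _ => ?_
  rw [principalAngle_eq hPV, Function.comp_apply, Function.comp_apply, hdiag, Real.arccos_cos
    (farAngle_nonneg L W s _)]
  unfold farAngle
  split_ifs
  · exact (principalAngle_le_pi_div_two L W _).trans (by linarith [Real.pi_pos])
  · linarith [Real.pi_pos]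

end FarPlanes

end Grass

/-! ### Embedding a smaller Grassmannian by adding a fixed subspace -/

theorem LinearIsometry.finrank_map {V V' : Type*} [NormedAddCommGroup V] [InnerProductSpace ℝ V]
    [NormedAddCommGroup V'] [InnerProductSpace ℝ V'] (φ : V →ₗᵢ[ℝ] V') (S : Submodule ℝ V) :
    Module.finrank ℝ (S.map φ.toLinearMap) = Module.finrank ℝ S :=
  (Submodule.equivMapOfInjective φ.toLinearMap φ.injective S).symm.finrank_eq

namespace Grass

theorem isInducing_starProjection (k n : ℕ) :
    Topology.IsInducing fun E : Grass k n => E.space.starProjection := ⟨rfl⟩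

theorem isEmbedding_starProjection (k n : ℕ) :
    Topology.IsEmbedding fun E : Grass k n => E.space.starProjection :=
  ⟨isInducing_starProjection k n, fun _ _ h => Subtype.ext (Submodule.starProjection_inj.1 h)⟩

section Join

variable {d k m n : ℕ} (φ : Euc m →ₗᵢ[ℝ] Euc n) {V : Submodule ℝ (Euc n)}
  (hφ : LinearMap.range φ.toLinearMap ≤ Vᗮ)

theorem finrank_map_sup (hφ : LinearMap.range φ.toLinearMap ≤ Vᗮ)
    (hd : d + Module.finrank ℝ V = k) (B : Grass d m) :
    Module.finrank ℝ (B.space.map φ.toLinearMap ⊔ V : Submodule ℝ (Euc n)) = k := by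
  have h1 := Submodule.finrank_sup_add_finrank_inf_eq (B.space.map φ.toLinearMap) V
  have h2 : B.space.map φ.toLinearMap ⊓ V = ⊥ := by
    rw [eq_bot_iff, ← V.inf_orthogonal_eq_bot, inf_comm]
    exact inf_le_inf_left _ (LinearMap.map_le_range.trans hφ)
  have h3 : Module.finrank ℝ (B.space.map φ.toLinearMap) = d := by
    rw [φ.finrank_map, B.finrank_space]
  rw [h2, finrank_bot, h3] at h1
  omega

/-- The map `B ↦ φ(B) ⊕ V` between Grassmannians, for an isometric embedding `φ` with image
orthogonal to `V`. -/
noncomputable def join (hd : d + Module.finrank ℝ V = k) (B : Grass d m) : Grass k n :=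
  ⟨B.space.map φ.toLinearMap ⊔ V, finrank_map_sup φ hφ hd B⟩

theorem space_join (hd : d + Module.finrank ℝ V = k) (B : Grass d m) :
    (join φ hφ hd B).space = B.space.map φ.toLinearMap ⊔ V := rfl

/-- The summands `φ(B)` and `V` are orthogonal, so their projections add, and the projection onto
`φ(B)` is that of `B` conjugated by the isometry. -/
theorem starProjection_join (hd : d + Module.finrank ℝ V = k) (B : Grass d m) :
    (join φ hφ hd B).space.starProjection =
      φ.toContinuousLinearMap ∘L B.space.starProjection ∘L
        ContinuousLinearMap.adjoint φ.toContinuousLinearMap + V.starProjection := by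
  ext1 x
  refine Submodule.eq_starProjection_of_mem_of_inner_eq_zero ?_ ?_
  · refine Submodule.add_mem_sup ⟨_, B.space.starProjection_apply_mem _, rfl⟩
      (V.starProjection_apply_mem x)
  · intro w hw
    obtain ⟨y, ⟨b, hb, rfl⟩, v, hv, rfl⟩ := Submodule.mem_sup.1 hw
    set Φ := φ.toContinuousLinearMap
    have e1 : ⟪x, Φ b⟫ = ⟪B.space.starProjection (ContinuousLinearMap.adjoint Φ x), b⟫ := by
      have := B.space.starProjection_inner_eq_zero (ContinuousLinearMap.adjoint Φ x) b hb
      rw [inner_sub_left, ContinuousLinearMap.adjoint_inner_left] at this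
      linarith
    have e2 := V.starProjection_inner_eq_zero x v hv
    have e3 : ∀ z, ∀ u ∈ V, ⟪u, Φ z⟫ = 0 := fun z u hu => hφ ⟨z, rfl⟩ u hu
    have e4 : ⟪Φ (B.space.starProjection (ContinuousLinearMap.adjoint Φ x)), Φ b⟫ = ⟪x, Φ b⟫ := by
      rw [e1]; exact φ.inner_map_map _ _
    rw [inner_sub_left] at e2
    change ⟪x - (Φ (B.space.starProjection (ContinuousLinearMap.adjoint Φ x))
      + V.starProjection x), Φ b + v⟫ = 0
    rw [inner_sub_left, inner_add_left, inner_add_right, inner_add_right, inner_add_right, e4,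
      e3 _ _ (V.starProjection_apply_mem x), real_inner_comm v (Φ _), e3 _ v hv]
    linarith

/-- On projections the map is `T ↦ Φ T Φ* + P_V`. Since `Φ* Φ = 1` and `P_V Φ = 0`, it has the
continuous left inverse `S ↦ Φ* S Φ`. -/
theorem isEmbedding_join (hd : d + Module.finrank ℝ V = k) :
    Topology.IsEmbedding (join φ hφ hd : Grass d m → Grass k n) := by
  set Φ := φ.toContinuousLinearMap with hΦ
  have h1 : Topology.IsEmbedding fun T : Euc m →L[ℝ] Euc m =>
      Φ ∘L T ∘L ContinuousLinearMap.adjoint Φ + V.starProjection := by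
    refine Topology.IsEmbedding.of_leftInverse
      (f := fun S : Euc n →L[ℝ] Euc n => ContinuousLinearMap.adjoint Φ ∘L S ∘L Φ) ?_
      (by fun_prop) (by fun_prop)
    intro T
    have hadj : ∀ x, ContinuousLinearMap.adjoint Φ (Φ x) = x := fun x =>
      ext_inner_right ℝ fun y => by
        rw [ContinuousLinearMap.adjoint_inner_left]; exact φ.inner_map_map x y
    have hV : ∀ x, V.starProjection (Φ x) = 0 := fun x =>
      V.starProjection_apply_eq_zero_iff.2 (hφ ⟨x, rfl⟩)
    ext1 x
    simp [hadj, hV]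
  have h2 := h1.comp (isEmbedding_starProjection d m)
  have h3 : (fun E : Grass k n => E.space.starProjection) ∘ join φ hφ hd =
      (fun T : Euc m →L[ℝ] Euc m => Φ ∘L T ∘L ContinuousLinearMap.adjoint Φ + V.starProjection)
        ∘ fun B : Grass d m => B.space.starProjection :=
    funext fun B => starProjection_join φ hφ hd B
  rw [← h3] at h2
  exact (isEmbedding_starProjection k n).of_comp_iff.1 h2

theorem mem_range_join_iff (hd : d + Module.finrank ℝ V = k) (E : Grass k n) :
    E ∈ Set.range (join φ hφ hd : Grass d m → Grass k n) ↔
      ∃ B : Submodule ℝ (Euc n), B ≤ LinearMap.range φ.toLinearMap ∧ Module.finrank ℝ B = d ∧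
        E.space = B ⊔ V := by
  constructor
  · rintro ⟨B, rfl⟩
    exact ⟨B.space.map φ.toLinearMap, LinearMap.map_le_range,
      by rw [φ.finrank_map, B.finrank_space], rfl⟩
  · rintro ⟨B, hB, hBd, hE⟩
    have hmap : (B.comap φ.toLinearMap).map φ.toLinearMap = B := Submodule.map_comap_eq_of_le hB
    refine ⟨⟨B.comap φ.toLinearMap, ?_⟩, Subtype.ext ?_⟩
    · rw [← hBd, ← φ.finrank_map, hmap]
    · change (B.comap φ.toLinearMap).map φ.toLinearMap ⊔ V = E.space
      rw [hmap, hE]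

end Join

/-! ### The maximum and the set of maximizers -/

section Maximizers

variable {k n s : ℕ} {L W : Grass k n}

theorem exists_mem_schubert_dist_eq (hkn : 2 * k ≤ n) (hsk : s ≤ k)
    (hL : L ∈ regularPlanes W) :
    ∃ E ∈ schubert W s, dist L E =
      Real.sqrt ((∑ i : Fin k with k - s ≤ i.val, principalAngle L W i ^ 2)
        + ((k - s : ℕ) : ℝ) * (Real.pi / 2) ^ 2) := by
  obtain ⟨p, q, h⟩ := exists_isPrincipalVectors L W
  have hV := finrank_span_image_last hsk h
  set V := Submodule.span ℝ (q '' {i : Fin k | k - s ≤ i.val}) with hVdef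
  have hA := finrank_orthogonal_inf_orthogonal hL (span_image_last_le h) hV
  -- The hypothesis `2 * k ≤ n` gives `k - s ≤ n - k - s`, which leaves room for `B`.
  obtain ⟨B, hBA, hB⟩ := (L.spaceᗮ ⊓ Vᗮ).exists_le_finrank_eq (d := k - s) (by rw [hA]; omega)
  have hBV : B ⊓ V = ⊥ := by
    rw [eq_bot_iff, ← V.inf_orthogonal_eq_bot, inf_comm]
    exact inf_le_inf_left _ (hBA.trans inf_le_right)
  have hrank := Submodule.finrank_sup_add_finrank_inf_eq B V
  rw [hBV, finrank_bot, hB, hV] at hrank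
  have := mem_schubert_and_dist_eq_of_eq_sup hsk h hBA hB
    (E := ⟨B ⊔ V, by omega⟩) rfl
  exact ⟨_, this⟩

theorem isGreatest_dist_schubert (hkn : 2 * k ≤ n) (hsk : s ≤ k)
    (hL : L ∈ regularPlanes W) :
    IsGreatest ((fun E => dist L E) '' schubert W s)
      (Real.sqrt ((∑ i : Fin k with k - s ≤ i.val, principalAngle L W i ^ 2)
        + ((k - s : ℕ) : ℝ) * (Real.pi / 2) ^ 2)) := by
  obtain ⟨E, hE, hd⟩ := exists_mem_schubert_dist_eq hkn hsk hL
  refine ⟨⟨E, hE, hd⟩, ?_⟩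
  rintro _ ⟨E', hE', rfl⟩
  exact dist_le_of_mem_schubert hsk L W hE'

theorem mem_maximizers_iff (hkn : 2 * k ≤ n) (hsk : s ≤ k)
    (hL : L ∈ regularPlanes W) {p q : Fin k → Euc n} (h : IsPrincipalVectors L W p q)
    (E : Grass k n) : E ∈ maximizers L W s ↔ ∃ B : Submodule ℝ (Euc n),
      B ≤ L.spaceᗮ ⊓ (Submodule.span ℝ (q '' {i : Fin k | k - s ≤ i.val}))ᗮ ∧
        Module.finrank ℝ B = k - s ∧
        E.space = B ⊔ Submodule.span ℝ (q '' {i : Fin k | k - s ≤ i.val}) := by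
  constructor
  · rintro ⟨hE, hmax⟩
    obtain ⟨E', hE', hd⟩ := exists_mem_schubert_dist_eq hkn hsk hL
    refine exists_eq_sup_of_dist_eq hsk h hL hE
      (le_antisymm (dist_le_of_mem_schubert hsk L W hE) ?_)
    rw [← hd]
    exact hmax hE'
  · rintro ⟨B, hBA, hB, hE⟩
    obtain ⟨hmem, hd⟩ := mem_schubert_and_dist_eq_of_eq_sup hsk h hBA hB hE
    refine ⟨hmem, fun E' hE' => ?_⟩
    change dist L E' ≤ dist L E
    rw [hd]
    exact dist_le_of_mem_schubert hsk L W hE'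

end Maximizers

end Grass

/-! ### A determinant certifying simple eigenvalues different from 0 and 1 -/

namespace Matrix

variable {k : ℕ} {R S : Type*} [CommRing R] [CommRing S]

/-- The matrix with columns `u, M u, …, M^(k-1) u`, for the vector `u = (1, …, 1)`. -/
def krylov (M : Matrix (Fin k) (Fin k) R) : Matrix (Fin k) (Fin k) R :=
  of fun i j => ∑ l, (M ^ (j : ℕ)) i l

/-- For a real symmetric `M`, this is nonzero only if the eigenvalues of `M` are distinct and
different from `0` and `1`. -/
def regularityDet (M : Matrix (Fin k) (Fin k) R) : R := M.krylov.det * M.det * (1 - M).det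

theorem map_krylov (f : R →+* S) (M : Matrix (Fin k) (Fin k) R) :
    f.mapMatrix M.krylov = (f.mapMatrix M).krylov := by
  ext i j
  simp only [krylov, RingHom.mapMatrix_apply, map_apply, of_apply, map_sum]
  refine Finset.sum_congr rfl fun l _ => ?_
  rw [← RingHom.mapMatrix_apply, ← map_pow, RingHom.mapMatrix_apply, map_apply]

theorem map_regularityDet (f : R →+* S) (M : Matrix (Fin k) (Fin k) R) :
    f M.regularityDet = (f.mapMatrix M).regularityDet := by
  simp only [regularityDet, map_mul, RingHom.map_det, map_krylov, map_sub, map_one]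

theorem krylov_diagonal (d : Fin k → R) : (diagonal d).krylov = vandermonde d := by
  ext i j
  rw [krylov, of_apply, diagonal_pow, vandermonde_apply, Finset.sum_eq_single i]
  · simp
  · intro l _ hl
    exact diagonal_apply_ne _ hl.symm
  · simp

theorem regularityDet_diagonal_ne_zero {d : Fin k → ℝ} (hd : Function.Injective d)
    (h0 : ∀ i, d i ≠ 0) (h1 : ∀ i, d i ≠ 1) : (diagonal d).regularityDet ≠ 0 := by
  rw [regularityDet, krylov_diagonal, ← diagonal_one, diagonal_sub, det_diagonal, det_diagonal]
  refine mul_ne_zero (mul_ne_zero (det_vandermonde_ne_zero_iff.2 hd)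
    (Finset.prod_ne_zero_iff.2 fun i _ => h0 i))
    (Finset.prod_ne_zero_iff.2 fun i _ => sub_ne_zero.2 (h1 i).symm)

variable {M : Matrix (Fin k) (Fin k) ℝ}

theorem eigenvalue_ne_zero_of_regularityDet_ne_zero (hM : M.regularityDet ≠ 0)
    {x : Fin k → ℝ} (hx : x ≠ 0) {c : ℝ} (hc : M *ᵥ x = c • x) : c ≠ 0 := by
  rintro rfl
  rw [zero_smul] at hc
  exact hM (by rw [regularityDet, exists_mulVec_eq_zero_iff.1 ⟨x, hx, hc⟩]; ring)

theorem eigenvalue_ne_one_of_regularityDet_ne_zero (hM : M.regularityDet ≠ 0)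
    {x : Fin k → ℝ} (hx : x ≠ 0) {c : ℝ} (hc : M *ᵥ x = c • x) : c ≠ 1 := by
  rintro rfl
  have : (1 - M) *ᵥ x = 0 := by rw [sub_mulVec, hc, one_mulVec, one_smul, sub_self]
  exact hM (by rw [regularityDet, exists_mulVec_eq_zero_iff.1 ⟨x, hx, this⟩, mul_zero])

/-- By symmetry `x` is also a left eigenvector, so `x ᵥ* M.krylov` has entries `c ^ j * ∑ i, x i`.
If the sum were zero, the Krylov matrix would be singular. -/
theorem sum_ne_zero_of_regularityDet_ne_zero (hM : M.regularityDet ≠ 0) (hsymm : Mᵀ = M)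
    {x : Fin k → ℝ} (hx : x ≠ 0) {c : ℝ} (hc : M *ᵥ x = c • x) : ∑ i, x i ≠ 0 := by
  intro hsum
  have hpow : ∀ j : ℕ, x ᵥ* (M ^ j) = c ^ j • x := by
    intro j
    induction j with
    | zero => simp
    | succ j ih =>
      rw [pow_succ, ← vecMul_vecMul, ih, smul_vecMul, ← mulVec_transpose, hsymm, hc, smul_smul,
        pow_succ]
  have hzero : x ᵥ* M.krylov = 0 := by
    ext j
    have h1 : (x ᵥ* M.krylov) j = ∑ l, (x ᵥ* (M ^ (j : ℕ))) l := by
      simp only [vecMul, dotProduct, krylov, of_apply, Finset.mul_sum]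
      rw [Finset.sum_comm]
    rw [h1, hpow]
    simp [← Finset.mul_sum, hsum]
  exact hM (by rw [regularityDet, exists_vecMul_eq_zero_iff.1 ⟨x, hx, hzero⟩]; ring)

/-- A two-dimensional eigenspace would contain the nonzero vector `(∑ y) x - (∑ x) y`, whose
coordinates sum to zero. -/
theorem eigenvalue_ne_of_regularityDet_ne_zero (hM : M.regularityDet ≠ 0) (hsymm : Mᵀ = M)
    {x y : Fin k → ℝ} (hxy : LinearIndependent ℝ ![x, y]) {c d : ℝ} (hc : M *ᵥ x = c • x)
    (hd : M *ᵥ y = d • y) : c ≠ d := by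
  rintro rfl
  rw [LinearIndependent.pair_iff] at hxy
  have hx : x ≠ 0 := by
    rintro rfl
    exact one_ne_zero (hxy 1 0 (by simp)).1
  have hz : (∑ i, y i) • x - (∑ i, x i) • y ≠ 0 := by
    intro h0
    exact sum_ne_zero_of_regularityDet_ne_zero hM hsymm hx hc
      (neg_eq_zero.1 (hxy (∑ i, y i) (-∑ i, x i) (by rw [neg_smul, ← sub_eq_add_neg, h0])).2)
  refine sum_ne_zero_of_regularityDet_ne_zero hM hsymm hz (c := c) ?_ ?_
  · rw [mulVec_sub, mulVec_smul, mulVec_smul, hc, hd, smul_sub, smul_comm c, smul_comm c]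
  · simp only [Pi.sub_apply, Pi.smul_apply, smul_eq_mul, Finset.sum_sub_distrib, ← Finset.mul_sum]
    ring

end Matrix

/-! ### Regular planes through the compression of the projection -/

namespace Grass

variable {k n : ℕ}

/-- The matrix, in the family `w`, of the compression of the orthogonal projection onto `L`. -/
noncomputable def compression (w : Fin k → Euc n) (L : Grass k n) : Matrix (Fin k) (Fin k) ℝ :=
  Matrix.of fun i j => ⟪w i, L.space.starProjection (w j)⟫

/-- The entries of `compression w L`, as polynomials in the entries of the projection onto `L`. -/
noncomputable def compressionPoly (w : Fin k → Euc n) :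
    Matrix (Fin k) (Fin k) (MvPolynomial (Fin n × Fin n) ℝ) :=
  Matrix.of fun i j => ∑ a, ∑ b, MvPolynomial.C (w i a * w j b) * MvPolynomial.X (a, b)

theorem sum_smul_single (x : Euc n) : x = ∑ a, x a • EuclideanSpace.single a (1 : ℝ) := by
  conv_lhs => rw [← (EuclideanSpace.basisFun (Fin n) ℝ).sum_repr x]
  simp

theorem inner_starProjection_eq_sum_coord (L : Grass k n) (x y : Euc n) :
    ⟪x, L.space.starProjection y⟫ = ∑ a, ∑ b, x a * y b * L.coord (a, b) := by
  conv_lhs => rw [sum_smul_single x, sum_smul_single y]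
  simp only [map_sum, map_smul, sum_inner, inner_sum, real_inner_smul_left, real_inner_smul_right,
    coord, mul_assoc]
  rw [Finset.sum_comm]
  exact Finset.sum_congr rfl fun a _ => Finset.sum_congr rfl fun b _ => by ring

theorem eval_compressionPoly (w : Fin k → Euc n) (L : Grass k n) :
    (MvPolynomial.eval L.coord).mapMatrix (compressionPoly w) = compression w L := by
  ext i j
  simp only [compressionPoly, compression, RingHom.mapMatrix_apply, Matrix.map_apply,
    Matrix.of_apply, inner_starProjection_eq_sum_coord]
  simp

theorem eval_regularityDet (w : Fin k → Euc n) (L : Grass k n) :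
    MvPolynomial.eval L.coord (compressionPoly w).regularityDet =
      (compression w L).regularityDet := by
  rw [Matrix.map_regularityDet, eval_compressionPoly]

theorem transpose_compression (w : Fin k → Euc n) (L : Grass k n) :
    (compression w L).transpose = compression w L := by
  ext i j
  simp only [compression, Matrix.transpose_apply, Matrix.of_apply]
  rw [← Submodule.inner_starProjection_left_eq_right, real_inner_comm]

/-- In the basis `w` of `W`, the coordinate vectors of the `q i` are independent eigenvectors of the
compression with eigenvalues `c_i²`. The determinant therefore makes the cosines distinct and keeps
them away from `0` and `1`. -/
theorem mem_regularPlanes_of_regularityDet_ne_zero {L W : Grass k n} {w : Fin k → Euc n}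
    (hw : Orthonormal ℝ w) (hwW : Submodule.span ℝ (Set.range w) = W.space)
    (hM : (compression w L).regularityDet ≠ 0) : L ∈ regularPlanes W := by
  obtain ⟨p, q, h⟩ := exists_isPrincipalVectors L W
  let x : Fin k → Fin k → ℝ := fun i l => ⟪w l, q i⟫
  have hsum : ∀ i, ∑ l, x i l • w l = q i := fun i =>
    (hw.eq_sum_inner hwW (h.mem_right i)).symm
  have hq0 : ∀ i, q i ≠ 0 := fun i => h.orthonormal_right.ne_zero i
  have hx0 : ∀ i, x i ≠ 0 := by
    intro i hi
    apply hq0 i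
    rw [← hsum, hi]
    simp
  have heig : ∀ i, (compression w L).mulVec (x i) = (⟪p i, q i⟫ ^ 2) • x i := by
    intro i
    ext l
    have h1 : (compression w L).mulVec (x i) l = ⟪w l, L.space.starProjection (q i)⟫ := by
      conv_rhs => rw [← hsum i]
      simp only [Matrix.mulVec, dotProduct, compression, Matrix.of_apply, map_sum, map_smul,
        inner_sum, real_inner_smul_right, mul_comm]
    have hwl : w l ∈ W.space := hwW ▸ Submodule.subset_span ⟨l, rfl⟩
    rw [h1, h.starProjection_right, real_inner_smul_right, real_inner_comm (p i) (w l),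
      h.inner_left_eq i hwl,
      Pi.smul_apply, smul_eq_mul, real_inner_comm (w l)]
    ring
  have hli : ∀ i j, i ≠ j → LinearIndependent ℝ ![x i, x j] := by
    intro i j hij
    rw [LinearIndependent.pair_iff]
    intro a b hab
    have h1 : a • q i + b • q j = 0 := by
      rw [← hsum i, ← hsum j, Finset.smul_sum, Finset.smul_sum, ← Finset.sum_add_distrib]
      refine Finset.sum_eq_zero fun l _ => ?_
      have := congrFun hab l
      simp only [Pi.add_apply, Pi.smul_apply, smul_eq_mul, Pi.zero_apply] at this
      rw [smul_smul, smul_smul, ← add_smul, this, zero_smul]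
    have h2 := congrArg (fun v => ⟪q i, v⟫) h1
    have h3 := congrArg (fun v => ⟪q j, v⟫) h1
    simp only [inner_add_right, real_inner_smul_right, inner_zero_right,
      real_inner_self_eq_norm_sq, h.orthonormal_right.1, h.orthonormal_right.2 hij,
      h.orthonormal_right.2 hij.symm] at h2 h3
    constructor <;> linarith
  have hc0 : ∀ i, 0 < ⟪p i, q i⟫ := fun i => lt_of_le_of_ne (h.nonneg i) fun h0 =>
    Matrix.eigenvalue_ne_zero_of_regularityDet_ne_zero hM (hx0 i) (heig i) (by rw [← h0]; norm_num)
  have hc1 : ∀ i, ⟪p i, q i⟫ < 1 := fun i => lt_of_le_of_ne (h.inner_le_one i) fun h1 =>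
    Matrix.eigenvalue_ne_one_of_regularityDet_ne_zero hM (hx0 i) (heig i) (by rw [h1]; norm_num)
  refine ⟨fun i => ?_, fun i j hij => ?_, fun i => ?_⟩
  · rw [principalAngle_eq h]
    exact Real.arccos_pos.2 (hc1 i)
  · rw [principalAngle_eq h, principalAngle_eq h]
    refine Real.strictAntiOn_arccos ⟨by linarith [hc0 j], (hc1 j).le⟩
      ⟨by linarith [hc0 i], (hc1 i).le⟩ (lt_of_le_of_ne (h.antitone hij.le) fun heq => ?_)
    exact Matrix.eigenvalue_ne_of_regularityDet_ne_zero hM (transpose_compression w L)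
      (hli i j hij.ne) (heig i) (heig j) (by rw [heq])
  · rw [principalAngle_eq h]
    exact Real.arccos_lt_pi_div_two.2 (hc0 i)

/-- Since `2 * k ≤ n`, there are `k` orthonormal vectors `u i` in `Wᗮ`. Rotating each `w i` towards
`u i` by its own angle, with squared cosine `d i`, gives a plane whose compression is diagonal. -/
theorem exists_regularityDet_ne_zero (hkn : 2 * k ≤ n) {W : Grass k n} {w : Fin k → Euc n}
    (hw : Orthonormal ℝ w) (hwW : Submodule.span ℝ (Set.range w) = W.space) :
    ∃ L : Grass k n, (compression w L).regularityDet ≠ 0 := by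
  have hdim := Submodule.finrank_add_finrank_orthogonal W.space
  rw [W.finrank_space, finrank_euclideanSpace_fin] at hdim
  obtain ⟨u', hu', hu'W⟩ := W.spaceᗮ.exists_orthonormal_span (d := n - k) (by omega)
  let u : Fin k → Euc n := fun i => u' (Fin.castLE (by omega) i)
  have hu : Orthonormal ℝ u := hu'.comp _ (Fin.castLE_injective _)
  have hwu : ∀ i j, ⟪w i, u j⟫ = 0 := fun i j => by
    have h1 : u j ∈ W.spaceᗮ := hu'W ▸ Submodule.subset_span ⟨_, rfl⟩
    exact h1 _ (hwW ▸ Submodule.subset_span ⟨i, rfl⟩)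
  -- Any `k` distinct numbers strictly between `0` and `1` would do.
  let d : Fin k → ℝ := fun i => ((i : ℝ) + 1) / (k + 1)
  have hd0 : ∀ i, 0 < d i := fun i => by positivity
  have hd1 : ∀ i, d i < 1 := fun i => by
    have h1 : (i : ℝ) < k := by exact_mod_cast i.2
    rw [div_lt_one (by positivity)]
    linarith
  have hdinj : Function.Injective d := by
    intro i j hij
    have h1 : ((i : ℝ) + 1) = j + 1 := by
      have hk : (k : ℝ) + 1 ≠ 0 := by positivity
      exact (div_left_inj' hk).1 hij
    exact Fin.ext (by exact_mod_cast add_right_cancel h1)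
  let b : Fin k → Euc n := fun i => √(d i) • w i + √(1 - d i) • u i
  have hww : ∀ i j, ⟪w i, w j⟫ = if i = j then 1 else 0 := orthonormal_iff_ite.1 hw
  have huu : ∀ i j, ⟪u i, u j⟫ = if i = j then 1 else 0 := orthonormal_iff_ite.1 hu
  have huw : ∀ i j, ⟪u i, w j⟫ = 0 := fun i j => by rw [real_inner_comm, hwu]
  have hwb : ∀ i j, ⟪w i, b j⟫ = if i = j then √(d j) else 0 := by
    intro i j
    simp only [b, inner_add_right, real_inner_smul_right, hww, hwu]
    split_ifs <;> simp
  have hb : Orthonormal ℝ b := by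
    rw [orthonormal_iff_ite]
    intro i j
    simp only [b, inner_add_left, inner_add_right, real_inner_smul_right, real_inner_smul_left,
      hww, hwu, huu, huw]
    split_ifs with hij
    · subst hij
      have h1 := Real.mul_self_sqrt (hd0 i).le
      have h2 := Real.mul_self_sqrt (sub_nonneg.2 (hd1 i).le)
      linarith
    · simp
  let L : Grass k n := ⟨Submodule.span ℝ (Set.range b), by
    rw [finrank_span_eq_card hb.linearIndependent, Fintype.card_fin]⟩
  refine ⟨L, ?_⟩
  have hdiag : compression w L = Matrix.diagonal d := by
    ext i j
    rw [compression, Matrix.of_apply, hb.starProjection_eq_sum_inner (S := L.space) rfl, inner_sum]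
    simp only [real_inner_smul_right, real_inner_comm (w j), hwb, Matrix.diagonal_apply]
    rw [Finset.sum_eq_single i]
    · rcases eq_or_ne i j with rfl | hij
      · simp [Real.mul_self_sqrt (hd0 i).le]
      · simp [hij, hij.symm]
    · intro l _ hl
      simp [hl.symm]
    · simp
  rw [hdiag]
  exact Matrix.regularityDet_diagonal_ne_zero hdinj (fun i => (hd0 i).ne') fun i => (hd1 i).ne

end Grass

/-! ### Rational curves and density of nonvanishing sets -/

/-- Clearing denominators in a polynomial expression in fractions with common denominator. -/
theorem MvPolynomial.exists_eval_div_mul_pow {σ K : Type*} [Field K] (P : MvPolynomial σ K)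
    (f : σ → Polynomial K) (g : Polynomial K) :
    ∃ (N : ℕ) (R : Polynomial K), ∀ t, g.eval t ≠ 0 →
      MvPolynomial.eval (fun i => (f i).eval t / g.eval t) P * g.eval t ^ N = R.eval t := by
  induction P using MvPolynomial.induction_on with
  | C a => exact ⟨0, Polynomial.C a, fun t _ => by simp⟩
  | add P Q hP hQ =>
    obtain ⟨N, R, hR⟩ := hP
    obtain ⟨N', R', hR'⟩ := hQ
    refine ⟨N + N', R * g ^ N' + R' * g ^ N, fun t ht => ?_⟩
    simp only [map_add, Polynomial.eval_add, Polynomial.eval_mul, Polynomial.eval_pow, ← hR t ht,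
      ← hR' t ht]
    ring
  | mul_X P i hP =>
    obtain ⟨N, R, hR⟩ := hP
    refine ⟨N + 1, R * f i, fun t ht => ?_⟩
    simp only [map_mul, MvPolynomial.eval_X, Polynomial.eval_mul, ← hR t ht]
    rw [pow_succ]
    field_simp

theorem Polynomial.eventually_eval_ne_zero {Q : Polynomial ℝ} (hQ : Q ≠ 0) (a : ℝ) :
    ∀ᶠ t in nhdsWithin a {a}ᶜ, Q.eval t ≠ 0 := by
  have hfin : ({t | Q.IsRoot t} \ {a}).Finite := (Polynomial.finite_setOfPred_isRoot hQ).sdiff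
  have hmem : ({t | Q.IsRoot t} \ {a})ᶜ ∈ nhds a :=
    hfin.isClosed.isOpen_compl.mem_nhds (by simp)
  filter_upwards [nhdsWithin_le_nhds hmem, self_mem_nhdsWithin] with t ht hta h0
  exact ht ⟨h0, hta⟩

/-- The coefficients solve the normal equations, whose matrix is the invertible Gram matrix. Unlike
Gram–Schmidt, this formula is rational in the entries of `v`. -/
theorem LinearIndependent.starProjection_span_eq_sum {V ι : Type*} [NormedAddCommGroup V]
    [InnerProductSpace ℝ V] [FiniteDimensional ℝ V] [Fintype ι] [DecidableEq ι] {v : ι → V}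
    (hv : LinearIndependent ℝ v) (x : V) :
    (Submodule.span ℝ (Set.range v)).starProjection x =
      ∑ i, ((Matrix.gram ℝ v)⁻¹.mulVec fun j => ⟪v j, x⟫) i • v i := by
  set c := (Matrix.gram ℝ v)⁻¹.mulVec fun j => ⟪v j, x⟫ with hc
  have hG : IsUnit (Matrix.gram ℝ v).det :=
    isUnit_iff_ne_zero.2 (Matrix.det_gram_ne_zero_iff_linearIndependent.2 hv)
  have hGc : ∀ l, ∑ i, ⟪v l, v i⟫ * c i = ⟪v l, x⟫ := by
    intro l
    have : (Matrix.gram ℝ v).mulVec c = fun j => ⟪v j, x⟫ := by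
      rw [hc, Matrix.mulVec_mulVec, Matrix.mul_nonsing_inv _ hG, Matrix.one_mulVec]
    exact congrFun this l
  refine Submodule.eq_starProjection_of_mem_of_inner_eq_zero
    (Submodule.sum_mem _ fun i _ => Submodule.smul_mem _ _ (Submodule.subset_span ⟨i, rfl⟩)) ?_
  intro w hw
  induction hw using Submodule.span_induction with
  | mem w hw =>
    obtain ⟨l, rfl⟩ := hw
    rw [real_inner_comm, inner_sub_right, inner_sum, ← hGc l, sub_eq_zero]
    exact Finset.sum_congr rfl fun i _ => by rw [real_inner_smul_right, mul_comm]
  | zero => simp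
  | add a b _ _ ha hb => rw [inner_add_right, ha, hb, add_zero]
  | smul r a _ ha => rw [real_inner_smul_right, ha, mul_zero]

namespace Grass

variable {k n : ℕ}

theorem starProjection_eq_sum_coord (L : Grass k n) :
    L.space.starProjection = ∑ a, ∑ b, L.coord (a, b) •
      (EuclideanSpace.proj b : Euc n →L[ℝ] ℝ).smulRight (EuclideanSpace.single a (1 : ℝ)) := by
  ext1 x
  refine ext_inner_left ℝ fun y => ?_
  rw [inner_starProjection_eq_sum_coord]
  simp only [sum_apply, smul_apply,
    ContinuousLinearMap.smulRight_apply, PiLp.proj_apply, inner_sum,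
    real_inner_smul_right, EuclideanSpace.inner_single_right]
  refine Finset.sum_congr rfl fun a _ => Finset.sum_congr rfl fun b _ => ?_
  simp
  ring

theorem tendsto_of_tendsto_coord {α : Type*} {l : Filter α} {γ : α → Grass k n} {L : Grass k n}
    (h : ∀ ab, Filter.Tendsto (fun t => (γ t).coord ab) l (nhds (L.coord ab))) :
    Filter.Tendsto γ l (nhds L) := by
  rw [(isInducing_starProjection k n).tendsto_nhds_iff]
  simp only [Function.comp_def, starProjection_eq_sum_coord]
  exact tendsto_finsetSum _ fun a _ => tendsto_finsetSum _ fun b _ => (h (a, b)).smul_const _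

/-- Any two planes lie on a rational curve in the Grassmannian. -/
theorem exists_rational_curve (L₀ L₁ : Grass k n) :
    ∃ (γ : ℝ → Grass k n) (f : Fin n × Fin n → Polynomial ℝ) (g : Polynomial ℝ),
      γ 0 = L₀ ∧ γ 1 = L₁ ∧ g.eval 0 ≠ 0 ∧ g.eval 1 ≠ 0 ∧
        ∀ t, g.eval t ≠ 0 → (γ t).coord = fun ab => (f ab).eval t / g.eval t := by
  classical
  obtain ⟨a, ha, haL⟩ := L₀.space.exists_orthonormal_span L₀.finrank_space
  obtain ⟨b, hb, hbL⟩ := L₁.space.exists_orthonormal_span L₁.finrank_space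
  -- The curve is spanned by the straight-line interpolation of the two bases.
  let v : ℝ → Fin k → Euc n := fun t i => (1 - t) • a i + t • b i
  have hv0 : v 0 = a := by ext1 i; simp [v]
  have hv1 : v 1 = b := by ext1 i; simp [v]
  -- The interpolated vectors may become dependent; `L₀` is a dummy value there. These parameters
  -- are exactly the zeros of the polynomial `G.det` below, which is the common denominator.
  let γ : ℝ → Grass k n := fun t =>
    if h : LinearIndependent ℝ (v t) then ⟨Submodule.span ℝ (Set.range (v t)), by
      rw [finrank_span_eq_card h, Fintype.card_fin]⟩ else L₀
  have hγ : ∀ t, LinearIndependent ℝ (v t) →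
      (γ t).space = Submodule.span ℝ (Set.range (v t)) := by
    intro t ht
    have h1 : γ t = ⟨Submodule.span ℝ (Set.range (v t)), by
      rw [finrank_span_eq_card ht, Fintype.card_fin]⟩ := dif_pos ht
    rw [h1]
    rfl
  let vp : Fin k → Fin n → Polynomial ℝ := fun i c =>
    Polynomial.C (a i c) * (1 - Polynomial.X) + Polynomial.C (b i c) * Polynomial.X
  have hvp : ∀ t i c, (vp i c).eval t = v t i c := by
    intro t i c
    simp [vp, v]
    ring
  let G : Matrix (Fin k) (Fin k) (Polynomial ℝ) := Matrix.of fun i j => ∑ c, vp i c * vp j c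
  have hG : ∀ t, (Polynomial.evalRingHom t).mapMatrix G = Matrix.gram ℝ (v t) := by
    intro t
    ext i j
    simp only [G, RingHom.mapMatrix_apply, Matrix.map_apply, Matrix.of_apply,
      Polynomial.coe_evalRingHom, Polynomial.eval_finsetSum, Polynomial.eval_mul, hvp,
      Matrix.gram_apply, PiLp.inner_apply, real_inner_eq_re_inner]
    exact Finset.sum_congr rfl fun c _ => by simp [mul_comm]
  have hdet : ∀ t, G.det.eval t = (Matrix.gram ℝ (v t)).det := by
    intro t
    rw [← hG, ← RingHom.map_det, Polynomial.coe_evalRingHom]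
  have hli : ∀ t, G.det.eval t ≠ 0 ↔ LinearIndependent ℝ (v t) := fun t => by
    rw [hdet, Matrix.det_gram_ne_zero_iff_linearIndependent]
  have hli0 : LinearIndependent ℝ (v 0) := hv0 ▸ ha.linearIndependent
  have hli1 : LinearIndependent ℝ (v 1) := hv1 ▸ hb.linearIndependent
  refine ⟨γ, fun cd => ∑ i, ∑ j, G.adjugate i j * vp j cd.2 * vp i cd.1, G.det,
    Subtype.ext ((hγ 0 hli0).trans (by rw [hv0, haL]; rfl)),
    Subtype.ext ((hγ 1 hli1).trans (by rw [hv1, hbL]; rfl)), (hli 0).2 hli0, (hli 1).2 hli1, ?_⟩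
  intro t ht
  have hadj : ∀ i j, (Matrix.gram ℝ (v t)).adjugate i j = (G.adjugate i j).eval t := by
    intro i j
    rw [← hG, ← RingHom.map_adjugate, RingHom.mapMatrix_apply, Matrix.map_apply,
      Polynomial.coe_evalRingHom]
  ext ⟨c, d⟩
  rw [coord]
  dsimp only
  have hproj : ∀ S : Submodule ℝ (Euc n), S = Submodule.span ℝ (Set.range (v t)) → ∀ x,
      S.starProjection x = (Submodule.span ℝ (Set.range (v t))).starProjection x := by
    rintro _ rfl _
    rfl
  rw [hproj _ (hγ t ((hli t).1 ht)), ((hli t).1 ht).starProjection_span_eq_sum, inner_sum, Matrix.inv_def,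
    Ring.inverse_eq_inv', ← hdet]
  simp only [EuclideanSpace.inner_single_left, Matrix.mulVec, dotProduct, Matrix.smul_apply, hadj,
    EuclideanSpace.inner_single_right, Polynomial.eval_finsetSum, Polynomial.eval_mul, hvp,
    smul_eq_mul, Finset.sum_div, PiLp.smul_apply, map_one, one_mul, conj_trivial]
  refine Finset.sum_congr rfl fun i _ => ?_
  rw [Finset.sum_mul]
  exact Finset.sum_congr rfl fun j _ => by ring

/-- The Grassmannian is irreducible: a polynomial that does not vanish identically on it is nonzero
on a dense subset. -/
theorem dense_eval_coord_ne_zero {P : MvPolynomial (Fin n × Fin n) ℝ} {L₁ : Grass k n}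
    (h₁ : MvPolynomial.eval L₁.coord P ≠ 0) :
    Dense {E : Grass k n | MvPolynomial.eval E.coord P ≠ 0} := by
  intro L₀
  obtain ⟨γ, f, g, rfl, rfl, hg0, hg1, hγ⟩ := exists_rational_curve L₀ L₁
  obtain ⟨N, R, hR⟩ := P.exists_eval_div_mul_pow f g
  -- Along the curve `P` times a power of `g` is the polynomial `R`, nonzero at `1`. The extra
  -- factor `g` also discards the parameters where the rational formula fails, so all but finitely
  -- many parameters are good, in particular those near `0` other than `0`.
  have hRg : R * g ≠ 0 := by
    intro h0
    have h2 := congrArg (Polynomial.eval 1) h0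
    rw [Polynomial.eval_mul, ← hR 1 hg1, ← hγ 1 hg1, Polynomial.eval_zero] at h2
    exact mul_ne_zero (mul_ne_zero h₁ (pow_ne_zero _ hg1)) hg1 h2
  have hev := Polynomial.eventually_eval_ne_zero hRg 0
  refine mem_closure_of_tendsto (f := γ) (b := nhdsWithin 0 {0}ᶜ) ?_ ?_
  · refine tendsto_of_tendsto_coord fun ab => ?_
    have h3 : Filter.Tendsto (fun t => (f ab).eval t / g.eval t) (nhdsWithin 0 {0}ᶜ)
        (nhds ((f ab).eval 0 / g.eval 0)) :=
      (((f ab).continuous.tendsto 0).div (g.continuous.tendsto 0) hg0).mono_left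
        nhdsWithin_le_nhds
    rw [hγ 0 hg0]
    refine h3.congr' ?_
    filter_upwards [hev] with t ht
    rw [Polynomial.eval_mul] at ht
    rw [hγ t (right_ne_zero_of_mul ht)]
  · filter_upwards [hev] with t ht
    rw [Polynomial.eval_mul] at ht
    have hgt := right_ne_zero_of_mul ht
    rw [← hR t hgt, ← hγ t hgt] at ht
    exact left_ne_zero_of_mul (left_ne_zero_of_mul ht)

theorem isGeneric_regularPlanes (hkn : 2 * k ≤ n) (W : Grass k n) :
    IsGeneric (regularPlanes W) := by
  obtain ⟨w, hw, hwW⟩ := W.space.exists_orthonormal_span W.finrank_space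
  obtain ⟨L₁, hL₁⟩ := exists_regularityDet_ne_zero hkn hw hwW
  refine ⟨(compressionPoly w).regularityDet, dense_eval_coord_ne_zero (L₁ := L₁) ?_, fun L hL => ?_⟩
  · rwa [eval_regularityDet]
  · rw [Set.mem_ofPred_eq, eval_regularityDet] at hL
    exact mem_regularPlanes_of_regularityDet_ne_zero hw hwW hL

end Grass

/-! ### The theorem -/

theorem mainTheorem2 (k n s : ℕ) (hkn : 2 * k ≤ n) (hs1 : 1 ≤ s) (hsk : s ≤ k)
    (W : Grass k n) :
    Grass.IsGeneric (Grass.regularPlanes W) ∧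
    ∀ L ∈ Grass.regularPlanes W,
      L ∉ Grass.schubert W s ∧
      -- the maximum is attained, with the stated value
      IsGreatest ((fun E => Grass.dist L E) '' Grass.schubert W s)
        (Real.sqrt ((∑ i : Fin k with k - s ≤ i.val, Grass.principalAngle L W i ^ 2)
          + ((k - s : ℕ) : ℝ) * (Real.pi / 2) ^ 2)) ∧
      -- the explicit description of the maximizers, through principal vectors
      ∀ p q : Fin k → Euc n, Grass.IsPrincipalVectors L W p q →
        ∀ EW A : Submodule ℝ (Euc n),
          EW = Submodule.span ℝ (q '' {i : Fin k | k - s ≤ i.val}) →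
          A = L.spaceᗮ ⊓ EWᗮ →
          Module.finrank ℝ EW = s ∧
          Module.finrank ℝ A = n - k - s ∧
          (∀ E : Grass k n, E ∈ Grass.maximizers L W s ↔
            ∃ B : Submodule ℝ (Euc n), B ≤ A ∧ Module.finrank ℝ B = k - s ∧
              E.space = B ⊔ EW) ∧
          -- the set of maximizers is a copy of `G(k-s, n-k-s)`, embedded by `B ↦ B ⊕ EW`
          ∀ φ : Euc (n - k - s) →ₗᵢ[ℝ] Euc n, LinearMap.range φ.toLinearMap = A →
            ∃ f : Grass (k - s) (n - k - s) → Grass k n,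
              (∀ B, (f B).space = B.space.map φ.toLinearMap ⊔ EW) ∧
              Topology.IsEmbedding f ∧
              Set.range f = Grass.maximizers L W s := by
  refine ⟨Grass.isGeneric_regularPlanes hkn W, fun L hL =>
    ⟨Grass.notMem_schubert_of_mem_regularPlanes hs1 hL,
      Grass.isGreatest_dist_schubert hkn hsk hL, ?_⟩⟩
  rintro p q h EW A hEW rfl
  have hrank : Module.finrank ℝ EW = s := hEW ▸ Grass.finrank_span_image_last hsk h
  have hmax := Grass.mem_maximizers_iff hkn hsk hL h
  rw [← hEW] at hmax
  refine ⟨hrank, Grass.finrank_orthogonal_inf_orthogonal hL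
    (hEW ▸ Grass.span_image_last_le h) hrank, hmax, fun φ hφ => ?_⟩
  have hφ' : LinearMap.range φ.toLinearMap ≤ EWᗮ := hφ.le.trans inf_le_right
  have hd : (k - s) + Module.finrank ℝ EW = k := by omega
  refine ⟨Grass.join φ hφ' hd, Grass.space_join φ hφ' hd, Grass.isEmbedding_join φ hφ' hd, ?_⟩
  ext E
  rw [Grass.mem_range_join_iff, hφ, hmax]
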